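/- For a function $B\colon\mathbb{Z}^2\to\mathbb{R}$ (a magnetic field) let $$A_B(n,n-e_j):=\delta_{j,1}\Big(\delta_{n_2>0}\sum_{m=1}^{n_2}B(n_1,m)-\delta_{n_2<0}\sum_{m=0}^{|n_2|-1}B(n_1,-m)\Big),\qquad e_1=(1,0),\ e_2=(0,1),$$ and let $\mathfrak{s}_{B,1},\mathfrak{s}_{B,2}$ be the magnetic translations on $\ell^2(\mathbb{Z}^2)$, $(\mathfrak{s}_{B,j}\psi)(n)=e^{iA_B(n,n-e_j)}\psi(n-e_j)$. Let $\mathfrak{A}_B:=C^*(\mathfrak{s}_{B,1},\mathfrak{s}_{B,2})\subseteq\mathcal{B}(\ell^2(\mathbb{Z}^2))$; it contains the flux operator $(\mathfrak{f}_B\psi)(n)=e^{iB(n)}\psi(n)$. For a constant field $B\equiv b$ write $\mathfrak{A}_b$ and $\mathfrak{s}_{b,j}$. Let $b_\llcorner,b_\ast\in\mathbb{R}$ with $b_\llcorner-b_\ast\notin2\pi\mathbb{Z}$, let $B$ be the quarter-plane field, $B(n)=b_\ast$ if $n_1\le0$ or $n_2\le0$ and $B(n)=b_\llcorner$ otherwise,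 and put $\mathfrak{A}:=\mathfrak{A}_B$, $\mathfrak{A}_{\rm bulk}:=\mathfrak{A}_{b_\llcorner}\oplus\mathfrak{A}_{b_\ast}$. Let $\mathfrak{r}_0,\mathfrak{u}_0\in\mathfrak{A}$ be the operators of multiplication by the characteristic functions of the half-lines $\{(j,0):j\ge0\}$ and $\{(0,j):j\ge0\}$ ($j$ an integer). Then there is exactly one surjective unital $*$-homomorphism ${\rm ev}\colon\mathfrak{A}\to\mathfrak{A}_{\rm bulk}$ with $${\rm ev}(\mathfrak{s}_{B,j})=(\mathfrak{s}_{b_\llcorner,j},\mathfrak{s}_{b_\ast,j})\ (j=1,2),\qquad {\rm ev}(\mathfrak{f}_B)=(e^{ib_\llcorner}\mathfrak{1},e^{ib_\ast}\mathfrak{1}),$$ and the interface algebra $\mathfrak{I}:=\ker({\rm ev})$ equals the (norm-)closed two-sided ideal of $\mathfrak{A}$ generated by $\mathfrak{r}_0$ and $\mathfrak{u}_0$. -/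

import Mathlib

open scoped lp ENNReal InnerProductSpace

noncomputable section

namespace MagneticQP

/-- The Hilbert space `ℓ²(ℤ²)`. -/
abbrev Hil : Type := ℓ²(ℤ × ℤ, ℂ)

/-- The algebra `B(ℓ²(ℤ²))` of bounded operators. -/
abbrev BdOp : Type := Hil →L[ℂ] Hil

theorem memlp_mul_shift (g : ℓ^∞(ℤ × ℤ, ℂ)) (γ : ℤ × ℤ) (ψ : Hil) :
    Memℓp (fun n : ℤ × ℤ => g n * ψ (n - γ)) 2 := by
  have h2 : (0 : ℝ) < (2 : ℝ≥0∞).toReal := by norm_num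
  apply memℓp_gen
  have h := (lp.memℓp ψ).summable h2
  have h' := ((Equiv.subRight γ).summable_iff.mpr h).mul_left (‖g‖ ^ (2 : ℝ≥0∞).toReal)
  refine Summable.of_nonneg_of_le (fun n => by positivity) (fun n => ?_) h'
  rw [norm_mul, Real.mul_rpow (norm_nonneg _) (norm_nonneg _)]
  simp only [Function.comp, Equiv.subRight_apply]
  gcongr
  exact lp.norm_apply_le_norm ENNReal.top_ne_zero g n

/-- The weighted translation `(T ψ)(n) = g(n) ψ(n - γ)` on `ℓ²(ℤ²)`, for `g ∈ ℓ^∞(ℤ²)` and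
`γ ∈ ℤ²`. -/
def weightedShift (g : ℓ^∞(ℤ × ℤ, ℂ)) (γ : ℤ × ℤ) : BdOp :=
  LinearMap.mkContinuous
    { toFun := fun ψ => ⟨fun n => g n * ψ (n - γ), memlp_mul_shift g γ ψ⟩
      map_add' := fun ψ φ => by
        ext n
        exact mul_add _ _ _
      map_smul' := fun c ψ => by
        ext n
        exact mul_left_comm _ _ _ }
    ‖g‖ (fun ψ => by
      have h2 : (0 : ℝ) < (2 : ℝ≥0∞).toReal := by norm_num
      refine lp.norm_le_of_tsum_le h2 (by positivity) ?_
      have h := (lp.memℓp ψ).summable h2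
      have h' := ((Equiv.subRight γ).summable_iff.mpr h).mul_left (‖g‖ ^ (2 : ℝ≥0∞).toReal)
      rw [Real.mul_rpow (norm_nonneg _) (norm_nonneg _), lp.norm_rpow_eq_tsum h2 ψ,
        ← (Equiv.subRight γ).tsum_eq (fun n => ‖ψ n‖ ^ (2 : ℝ≥0∞).toReal), ← tsum_mul_left]
      refine Summable.tsum_le_tsum (fun n => ?_) ((memlp_mul_shift g γ ψ).summable h2) h'
      rw [← Real.mul_rpow (norm_nonneg _) (norm_nonneg _)]
      refine Real.rpow_le_rpow (norm_nonneg _) ?_ h2.le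
      refine (norm_mul_le _ _).trans ?_
      exact mul_le_mul_of_nonneg_right (lp.norm_apply_le_norm ENNReal.top_ne_zero g n)
        (norm_nonneg _))

@[simp]
theorem weightedShift_apply (g : ℓ^∞(ℤ × ℤ, ℂ)) (γ : ℤ × ℤ) (ψ : Hil) (n : ℤ × ℤ) :
    weightedShift g γ ψ n = g n * ψ (n - γ) := rfl

/-- A function on `ℤ²` bounded by `1`, as an element of `ℓ^∞(ℤ²)`. -/
def bddFun (g : ℤ × ℤ → ℂ) (hg : ∀ n, ‖g n‖ ≤ 1) : ℓ^∞(ℤ × ℤ, ℂ) :=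
  ⟨g, memℓp_infty ⟨1, by rintro _ ⟨n, rfl⟩; exact hg n⟩⟩

@[simp]
theorem bddFun_apply (g : ℤ × ℤ → ℂ) (hg : ∀ n, ‖g n‖ ≤ 1) (n : ℤ × ℤ) :
    bddFun g hg n = g n := rfl

/-- The multiplication operator `(m_g ψ)(n) = g(n) ψ(n)`, for `g ∈ ℓ^∞(ℤ²)`. -/
def mulOp (g : ℓ^∞(ℤ × ℤ, ℂ)) : BdOp := weightedShift g 0

@[simp]
theorem mulOp_apply (g : ℓ^∞(ℤ × ℤ, ℂ)) (ψ : Hil) (n : ℤ × ℤ) :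
    mulOp g ψ n = g n * ψ n := by
  simp [mulOp]

/-- The canonical basis `e₁ = (1,0)`, `e₂ = (0,1)` of `ℤ²`, indexed by `0, 1`. -/
def e : Fin 2 → ℤ × ℤ := ![(1, 0), (0, 1)]

/-- The values `A_B(n, n - e_j)` of the standard vector potential of a magnetic field
`B : ℤ² → ℝ` (the index `j = 0` is the direction `e₁`). -/
def potential (B : ℤ × ℤ → ℝ) (j : Fin 2) (n : ℤ × ℤ) : ℝ :=
  if j = 0 then
    (if 0 < n.2 then ∑ m ∈ Finset.Icc 1 n.2.natAbs, B (n.1, (m : ℤ)) else 0)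
      - (if n.2 < 0 then ∑ m ∈ Finset.range n.2.natAbs, B (n.1, -(m : ℤ)) else 0)
  else 0

/-- The phase `n ↦ exp(i A_B(n, n - e_j))`. -/
def phase (B : ℤ × ℤ → ℝ) (j : Fin 2) : ℓ^∞(ℤ × ℤ, ℂ) :=
  bddFun (fun n => Complex.exp (Complex.I * (potential B j n : ℂ)))
    (fun n => by rw [Complex.norm_exp_I_mul_ofReal])

/-- The magnetic translation `(s_j ψ)(n) = exp(i A_B(n, n - e_j)) ψ(n - e_j)`. -/
def magTrans (B : ℤ × ℤ → ℝ) (j : Fin 2) : BdOp := weightedShift (phase B j) (e j)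

/-- The flux function `f_B(n) = exp(i B(n))`. -/
def fluxFun (B : ℤ × ℤ → ℝ) : ℓ^∞(ℤ × ℤ, ℂ) :=
  bddFun (fun n => Complex.exp (Complex.I * (B n : ℂ)))
    (fun n => by rw [Complex.norm_exp_I_mul_ofReal])

/-- The flux operator, multiplication by `f_B`. -/
def flux (B : ℤ × ℤ → ℝ) : BdOp := mulOp (fluxFun B)

/-- The magnetic algebra `C*(s₁, s₂)`: the unital C⋆-subalgebra of `B(ℓ²(ℤ²))` generated by the
magnetic translations of the field `B`. -/
def magAlg (B : ℤ × ℤ → ℝ) : StarSubalgebra ℂ BdOp :=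
  (StarAlgebra.adjoin ℂ (Set.range (magTrans B))).topologicalClosure

/-- The quarter-plane magnetic field, equal to `bq` on the quarter plane `n₁, n₂ ≥ 1` and to `bs`
elsewhere. -/
def quarterField (bq bs : ℝ) (n : ℤ × ℤ) : ℝ := if n.1 ≤ 0 ∨ n.2 ≤ 0 then bs else bq

/-- The constant magnetic field of strength `b`. -/
def constField (b : ℝ) (_ : ℤ × ℤ) : ℝ := b

/-- The right half-line at `n`. -/
def rightHalfLine (n : ℤ × ℤ) : Set (ℤ × ℤ) := {m | ∃ j : ℕ, m = n + j • e 0}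

/-- The up half-line at `n`. -/
def upHalfLine (n : ℤ × ℤ) : Set (ℤ × ℤ) := {m | ∃ j : ℕ, m = n + j • e 1}

/-- The characteristic function of `O ⊆ ℤ²`. -/
def charFun (O : Set (ℤ × ℤ)) : ℓ^∞(ℤ × ℤ, ℂ) :=
  bddFun (O.indicator 1) (fun n => by
    classical
    by_cases h : n ∈ O <;> simp [h])

/-- The projection `r_n`, multiplication by the characteristic function of the right half-line. -/
def projR (n : ℤ × ℤ) : BdOp := mulOp (charFun (rightHalfLine n))

/-- The projection `u_n`, multiplication by the characteristic function of the up half-line. -/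
def projU (n : ℤ × ℤ) : BdOp := mulOp (charFun (upHalfLine n))

/-! The operators `s_j`, `f_B`, `r_0`, `u_0` lie in the magnetic algebra. -/

theorem star_weightedShift_apply (g : ℓ^∞(ℤ × ℤ, ℂ)) (γ : ℤ × ℤ) (ψ : Hil) (n : ℤ × ℤ) :
    (star (weightedShift g γ)) ψ n = star (g (n + γ)) * ψ (n + γ) := by
  have hb : Memℓp (fun n : ℤ × ℤ => star (g (n + γ))) ∞ :=
    memℓp_infty ⟨‖g‖, by
      rintro _ ⟨m, rfl⟩
      simpa using lp.norm_apply_le_norm ENNReal.top_ne_zero g (m + γ)⟩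
  have h : star (weightedShift g γ) = weightedShift ⟨_, hb⟩ (-γ) := by
    rw [ContinuousLinearMap.star_eq_adjoint, eq_comm, ContinuousLinearMap.eq_adjoint_iff]
    intro x y
    rw [lp.inner_eq_tsum, lp.inner_eq_tsum, ← (Equiv.subRight γ).tsum_eq]
    refine tsum_congr fun m => ?_
    simp only [Equiv.subRight_apply, weightedShift_apply, RCLike.inner_apply, map_mul,
      starRingEnd_apply, star_star, sub_add_cancel, sub_neg_eq_add]
    ring
  rw [h]
  simp

theorem magTrans_mem (B : ℤ × ℤ → ℝ) (j : Fin 2) : magTrans B j ∈ magAlg B :=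
  StarSubalgebra.le_topologicalClosure _ (StarAlgebra.subset_adjoin ℂ _ ⟨j, rfl⟩)

theorem phase_mul_star (B : ℤ × ℤ → ℝ) (j : Fin 2) (n : ℤ × ℤ) :
    phase B j n * star (phase B j n) = 1 := by
  have h : ‖phase B j n‖ = 1 := Complex.norm_exp_I_mul_ofReal _
  have := Complex.mul_conj' (phase B j n)
  rw [h] at this
  simpa using this

/-- The vector potential has circulation `B`. -/
theorem potential_circ (B : ℤ × ℤ → ℝ) (n : ℤ × ℤ) :
    potential B 0 n - potential B 0 (n - e 1) = B n := by
  obtain ⟨a, k⟩ := n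
  simp only [potential, e, if_true, Matrix.cons_val_one, Matrix.cons_val_zero, Prod.mk_sub_mk,
    sub_zero]
  rcases lt_trichotomy k 1 with h | h | h
  · obtain ⟨m, rfl⟩ : ∃ m : ℕ, k = -(m : ℤ) := ⟨k.natAbs, by omega⟩
    have h1 : (-(m : ℤ) - 1).natAbs = m + 1 := by omega
    rw [h1, Finset.sum_range_succ]
    rcases Nat.eq_zero_or_pos m with rfl | hm
    · simp
    · rw [if_neg (by omega), if_pos (by omega), if_neg (by omega), if_pos (by omega)]
      simp
  · subst h
    simp
  · obtain ⟨m, rfl⟩ : ∃ m : ℕ, k = (m : ℤ) + 2 := ⟨(k - 2).natAbs, by omega⟩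
    have h1 : ((m : ℤ) + 2).natAbs = m + 1 + 1 := by omega
    have h2 : ((m : ℤ) + 2 - 1).natAbs = m + 1 := by omega
    rw [h1, h2, Finset.sum_Icc_succ_top (by omega) _, if_pos (by omega), if_neg (by omega),
      if_pos (by omega), if_neg (by omega)]
    push_cast
    ring_nf

/-- The relation `s₁ s₂ s₁* s₂* = f_B`. -/
theorem magTrans_comm (B : ℤ × ℤ → ℝ) :
    magTrans B 0 * magTrans B 1 * star (magTrans B 0) * star (magTrans B 1) = flux B := by
  ext ψ n
  simp only [magTrans, flux, mul_apply_eq_comp, weightedShift_apply, mulOp_apply,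
    star_weightedShift_apply]
  have hp : ∀ m, phase B 1 m = 1 := fun m => by simp [phase, potential]
  have he : n - e 0 - e 1 + e 0 = n - e 1 := by abel
  rw [hp, hp, he, sub_add_cancel]
  have hf : phase B 0 n * star (phase B 0 (n - e 1)) = fluxFun B n := by
    have h1 : phase B 0 n = fluxFun B n * phase B 0 (n - e 1) := by
      simp only [phase, fluxFun, bddFun_apply]
      rw [← Complex.exp_add, ← mul_add, ← Complex.ofReal_add, ← potential_circ B n]
      ring_nf
    rw [h1, mul_assoc, phase_mul_star, mul_one]
  rw [← hf]
  simp [mul_assoc]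

theorem flux_mem (B : ℤ × ℤ → ℝ) : flux B ∈ magAlg B := by
  rw [← magTrans_comm]
  exact mul_mem (mul_mem (mul_mem (magTrans_mem B 0) (magTrans_mem B 1))
    (star_mem (magTrans_mem B 0))) (star_mem (magTrans_mem B 1))

/-- Conjugating a multiplication operator by `s_j*` translates its symbol by `-e_j`. -/
theorem star_conj_mulOp_apply (B : ℤ × ℤ → ℝ) (j : Fin 2) (T : BdOp) (g : ℤ × ℤ → ℂ)
    (hT : ∀ ψ n, T ψ n = g n * ψ n) (ψ : Hil) (n : ℤ × ℤ) :
    (star (magTrans B j) * T * magTrans B j) ψ n = g (n + e j) * ψ n := by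
  simp only [magTrans, mul_apply_eq_comp, star_weightedShift_apply, hT,
    weightedShift_apply, add_sub_cancel_right]
  linear_combination (g (n + e j) * ψ n) * phase_mul_star B j (n + e j)

theorem exp_sub_ne_zero {bq bs : ℝ} (h : ∀ k : ℤ, bq - bs ≠ 2 * Real.pi * k) :
    Complex.exp (Complex.I * bq) - Complex.exp (Complex.I * bs) ≠ 0 := by
  intro h0
  rw [sub_eq_zero, Complex.exp_eq_exp_iff_exists_int] at h0
  obtain ⟨k, hk⟩ := h0
  apply h k
  have : (bq : ℂ) = bs + 2 * Real.pi * k := by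
    apply mul_left_cancel₀ Complex.I_ne_zero
    rw [hk]
    ring
  have h2 : bq = bs + 2 * Real.pi * k := by exact_mod_cast this
  rw [h2]
  ring

theorem mem_of_diff {bq bs : ℝ} (h : ∀ k : ℤ, bq - bs ≠ 2 * Real.pi * k) (j : Fin 2)
    (T : BdOp) (O : Set (ℤ × ℤ)) (hT : T = mulOp (charFun O))
    (hO : ∀ n, n ∈ O ↔ ¬ ((n + e 0 + e 1).1 ≤ 0 ∨ (n + e 0 + e 1).2 ≤ 0) ∧
      ((n + e j).1 ≤ 0 ∨ (n + e j).2 ≤ 0))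
    (hj : ∀ n : ℤ × ℤ, ((n + e 0 + e 1).1 ≤ 0 ∨ (n + e 0 + e 1).2 ≤ 0) →
      ((n + e j).1 ≤ 0 ∨ (n + e j).2 ≤ 0)) :
    T ∈ magAlg (quarterField bq bs) := by
  set B := quarterField bq bs with hB
  have hc : ∀ (j : Fin 2) (X : BdOp), X ∈ magAlg B →
      star (magTrans B j) * X * magTrans B j ∈ magAlg B := fun j X hX =>
    mul_mem (mul_mem (star_mem (magTrans_mem B j)) hX) (magTrans_mem B j)
  have a0 : ∀ ψ n, flux B ψ n = fluxFun B n * ψ n := fun ψ n => mulOp_apply _ ψ n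
  have a1 := star_conj_mulOp_apply B j (flux B) (fun n => fluxFun B n) a0
  have a2 := star_conj_mulOp_apply B 1 (flux B) (fun n => fluxFun B n) a0
  have a3 := star_conj_mulOp_apply B 0 _ (fun n => fluxFun B (n + e 1)) a2
  have hne := exp_sub_ne_zero h
  have key : T = (Complex.exp (Complex.I * bq) - Complex.exp (Complex.I * bs))⁻¹ •
      (star (magTrans B 0) * (star (magTrans B 1) * flux B * magTrans B 1) * magTrans B 0
        - star (magTrans B j) * flux B * magTrans B j) := by
    ext ψ n
    rw [hT, mulOp_apply]
    rw [smul_apply, sub_apply, lp.coeFn_smul,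
      Pi.smul_apply, lp.coeFn_sub, Pi.sub_apply, a3, a1, smul_eq_mul, ← sub_mul, ← mul_assoc]
    congr 1
    rw [eq_inv_mul_iff_mul_eq₀ hne]
    have hO' := hO n
    have hj' := hj n
    simp only [fluxFun, charFun, bddFun_apply, hB, quarterField]
    by_cases p : (n + e 0 + e 1).1 ≤ 0 ∨ (n + e 0 + e 1).2 ≤ 0
    · have hn : n ∉ O := fun hn => (hO'.mp hn).1 p
      rw [if_pos p, if_pos (hj' p), Set.indicator_of_notMem hn]
      simp
    · by_cases q : (n + e j).1 ≤ 0 ∨ (n + e j).2 ≤ 0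
      · rw [if_neg p, if_pos q, Set.indicator_of_mem (hO'.mpr ⟨p, q⟩)]
        simp
      · have hn : n ∉ O := fun hn => q (hO'.mp hn).2
        rw [if_neg p, if_neg q, Set.indicator_of_notMem hn]
        simp
  rw [key]
  exact SMulMemClass.smul_mem _
    (sub_mem (hc 0 _ (hc 1 _ (flux_mem B))) (hc j _ (flux_mem B)))

theorem projR_mem {bq bs : ℝ} (h : ∀ k : ℤ, bq - bs ≠ 2 * Real.pi * k) :
    projR 0 ∈ magAlg (quarterField bq bs) := by
  refine mem_of_diff h 0 _ _ rfl ?_ ?_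
  · rintro ⟨a, b⟩
    simp only [rightHalfLine, e, Set.mem_ofPred_eq, zero_add, Matrix.cons_val_zero,
      Matrix.cons_val_one, Prod.mk_add_mk, Prod.smul_mk, Prod.mk.injEq]
    constructor
    · rintro ⟨j, h1, h2⟩
      simp at h1 h2
      omega
    · intro hh
      have ha : (a.natAbs : ℤ) = a := by omega
      exact ⟨a.natAbs, by simp only [nsmul_eq_mul]; omega, by simp only [nsmul_eq_mul]; omega⟩
  · rintro ⟨a, b⟩
    simp [e]
    omega

theorem projU_mem {bq bs : ℝ} (h : ∀ k : ℤ, bq - bs ≠ 2 * Real.pi * k) :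
    projU 0 ∈ magAlg (quarterField bq bs) := by
  refine mem_of_diff h 1 _ _ rfl ?_ ?_
  · rintro ⟨a, b⟩
    simp only [upHalfLine, e, Set.mem_ofPred_eq, zero_add, Matrix.cons_val_zero,
      Matrix.cons_val_one, Prod.mk_add_mk, Prod.smul_mk, Prod.mk.injEq]
    constructor
    · rintro ⟨j, h1, h2⟩
      simp at h1 h2
      omega
    · intro hh
      have hb : (b.natAbs : ℤ) = b := by omega
      exact ⟨b.natAbs, by simp only [nsmul_eq_mul]; omega, by simp only [nsmul_eq_mul]; omega⟩
  · rintro ⟨a, b⟩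
    simp [e]
    omega

/-- The magnetic translation `s_j` as an element of the magnetic algebra. -/
def s (B : ℤ × ℤ → ℝ) (j : Fin 2) : magAlg B := ⟨magTrans B j, magTrans_mem B j⟩

/-- The flux operator `f_B` as an element of the magnetic algebra. -/
def f (B : ℤ × ℤ → ℝ) : magAlg B := ⟨flux B, flux_mem B⟩

/-- The magnetic quarter-plane algebra. -/
abbrev QPAlg (bq bs : ℝ) : Type := magAlg (quarterField bq bs)

/-- The bulk algebra `A_{bq} ⊕ A_{bs}`, with componentwise operations and the maximum norm. -/
abbrev BulkAlg (bq bs : ℝ) : Type := magAlg (constField bq) × magAlg (constField bs)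

/-- A `*`-homomorphism from the quarter-plane algebra to the bulk algebra is the evaluation
homomorphism if it is surjective and sends the magnetic translations and the flux operator to
`(s_{bq,j}, s_{bs,j})` and `(exp(i bq) 1, exp(i bs) 1)`. -/
structure IsEvaluation {bq bs : ℝ} (ev : QPAlg bq bs →⋆ₐ[ℂ] BulkAlg bq bs) : Prop where
  surjective : Function.Surjective ev
  map_s : ∀ j, ev (s (quarterField bq bs) j) = (s (constField bq) j, s (constField bs) j)
  map_f : ev (f (quarterField bq bs)) =
    (Complex.exp (Complex.I * bq) • 1, Complex.exp (Complex.I * bs) • 1)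

/-- The projection `r_0` as an element of the quarter-plane algebra. -/
def r₀ {bq bs : ℝ} (h : ∀ k : ℤ, bq - bs ≠ 2 * Real.pi * k) : QPAlg bq bs :=
  ⟨projR 0, projR_mem h⟩

/-- The projection `u_0` as an element of the quarter-plane algebra. -/
def u₀ {bq bs : ℝ} (h : ∀ k : ℤ, bq - bs ≠ 2 * Real.pi * k) : QPAlg bq bs :=
  ⟨projU 0, projU_mem h⟩

/-- The (underlying set of the) closed two-sided ideal of a topological ring generated by `S`. -/
def closedIdeal {A : Type*} [Ring A] [TopologicalSpace A] (S : Set A) : Set A :=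
  closure (TwoSidedIdeal.span S : Set A)

end MagneticQP

end

/-! Write `P` for the projection onto the quarter plane and `J` for the closed ideal generated by
`r₀` and `u₀`. The two components of the evaluation are strong limits along the diagonal.
Translation by `(k, k)`, with a phase that makes it commute with the magnetic translations of a
constant field, carries each site into the quarter plane as `k → +∞` and out of it as `k → -∞`.
There the phases are exactly those of the fields `bq` and `bs`. Such limits are norm-contractive and
respect products and adjoints, so they define homomorphisms `φ` and `χ` on the whole algebra
(`StarStrongLimit.exists_starAlgHom`), and the evaluation is `(φ, χ)`.

The flux takes two distinct values, so `P` is an affine function of it and lies in the algebra, with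
image `(1, 0)`, which is central. The commutators of `P` with the translations are, up to unitary
factors on both sides, `u₀` and `r₀`. Hence the evaluation kills `J`.

For the reverse inclusion the image must be lifted back modulo `J`. The compression `T ↦ P T P` maps
the algebra of the field `bq` into the quarter-plane algebra (`IsCompression.corner_mem`), and `y P`
agrees with `P φ(y) P` modulo `J` (`IsCompression.mul_sub_cornerMap_mem`); the same holds for `1 -
P` and `χ`. If `φ y = χ y = 0`, then `y = y P + y (1 - P)` lies in `J`. The compressions are also
linear right inverses of `φ` and `χ`, which gives surjectivity. -/

noncomputable section

namespace MagneticQP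

open Filter Topology

/-! ### Strong limits along a family of isometries -/

section AsymptoticIntertwining

variable {H ι κ : Type*} [NormedAddCommGroup H] [InnerProductSpace ℂ H]

/-- `T` acts on the range of the isometries `V k` asymptotically as `T'`: the difference
`T V_k - V_k T'` tends strongly to `0`. -/
def StrongLimit (l : Filter κ) (V : κ → H →ₗᵢ[ℂ] H) (T T' : H →L[ℂ] H) : Prop :=
  ∀ ψ, Tendsto (fun k => T (V k ψ) - V k (T' ψ)) l (𝓝 0)

variable {l : Filter κ} {V : κ → H →ₗᵢ[ℂ] H} {T T' S S' : H →L[ℂ] H}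

theorem StrongLimit.add (hT : StrongLimit l V T T') (hS : StrongLimit l V S S') :
    StrongLimit l V (T + S) (T' + S') := fun ψ => by
  have h := (hT ψ).add (hS ψ)
  rw [add_zero] at h
  refine h.congr fun k => ?_
  simp only [add_apply, map_add]
  abel

theorem StrongLimit.mul (hT : StrongLimit l V T T') (hS : StrongLimit l V S S') :
    StrongLimit l V (T * S) (T' * S') := fun ψ => by
  have h := ((T.continuous.tendsto 0).comp (hS ψ)).add (hT (S' ψ))
  rw [map_zero, add_zero] at h
  refine h.congr fun k => ?_
  simp

theorem StrongLimit.algebraMap (c : ℂ) :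
    StrongLimit l V (algebraMap ℂ (H →L[ℂ] H) c) (algebraMap ℂ (H →L[ℂ] H) c) := fun ψ => by
  simpa [Algebra.algebraMap_eq_smul_one] using tendsto_const_nhds

/-- The maps `V k` are isometric, so the norm of `T' ψ` is seen in `V k (T' ψ)`, which is close to
`T (V k ψ)`. This bound yields uniqueness of limits and their extension to norm closures. -/
theorem StrongLimit.norm_le [l.NeBot] (hT : StrongLimit l V T T') : ‖T'‖ ≤ ‖T‖ := by
  refine T'.opNorm_le_bound (norm_nonneg _) fun ψ => ?_
  have h := (hT ψ).norm.add_const (‖T‖ * ‖ψ‖)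
  rw [norm_zero, zero_add] at h
  refine ge_of_tendsto' h fun k => ?_
  calc ‖T' ψ‖ = ‖V k (T' ψ)‖ := ((V k).norm_map _).symm
    _ = ‖T (V k ψ) - (T (V k ψ) - V k (T' ψ))‖ := by rw [sub_sub_cancel]
    _ ≤ ‖T (V k ψ)‖ + ‖T (V k ψ) - V k (T' ψ)‖ := norm_sub_le _ _
    _ ≤ ‖T‖ * ‖ψ‖ + ‖T (V k ψ) - V k (T' ψ)‖ := by
        gcongr
        simpa using T.le_opNorm (V k ψ)
    _ = _ := add_comm _ _

theorem StrongLimit.of_tendsto {Tn Tn' : ℕ → H →L[ℂ] H} (hn : ∀ n, StrongLimit l V (Tn n) (Tn' n))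
    (hT : Tendsto Tn atTop (𝓝 T)) (hT' : Tendsto Tn' atTop (𝓝 T')) : StrongLimit l V T T' := by
  intro ψ
  rw [Metric.tendsto_nhds]
  intro ε hε
  have h0 : Tendsto (fun n => (‖T - Tn n‖ + ‖Tn' n - T'‖) * ‖ψ‖) atTop (𝓝 0) := by
    have h1 := (tendsto_const_nhds.sub hT : Tendsto (fun n => T - Tn n) atTop (𝓝 (T - T))).norm
    have h2 := (hT'.sub tendsto_const_nhds : Tendsto (fun n => Tn' n - T') atTop (𝓝 (T' - T'))).norm
    simpa using (h1.add h2).mul_const ‖ψ‖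
  obtain ⟨n, hlt⟩ := (h0.eventually_lt_const (half_pos hε)).exists
  filter_upwards [(Metric.tendsto_nhds.1 (hn n ψ)) _ (half_pos hε)] with k hk
  rw [dist_zero_right] at hk ⊢
  have : T (V k ψ) - V k (T' ψ) =
      (T - Tn n) (V k ψ) + V k ((Tn' n - T') ψ) + (Tn n (V k ψ) - V k (Tn' n ψ)) := by
    simp only [sub_apply, map_sub]
    abel
  rw [this]
  have h1 : ‖(T - Tn n) (V k ψ)‖ ≤ ‖T - Tn n‖ * ‖ψ‖ := by
    simpa using (T - Tn n).le_opNorm (V k ψ)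
  have h2 : ‖V k ((Tn' n - T') ψ)‖ ≤ ‖Tn' n - T'‖ * ‖ψ‖ := by
    rw [(V k).norm_map]
    exact (Tn' n - T').le_opNorm ψ
  calc _ ≤ ‖(T - Tn n) (V k ψ)‖ + ‖V k ((Tn' n - T') ψ)‖ + ‖Tn n (V k ψ) - V k (Tn' n ψ)‖ :=
        norm_add₃_le
    _ < ε := by linarith

/-- A strong limit can be checked on vectors spanning a dense subspace. -/
theorem StrongLimit.of_dense {D : Set H} (hD : Dense (Submodule.span ℂ D : Set H))
    (h : ∀ ψ ∈ D, ∀ᶠ k in l, T (V k ψ) = V k (T' ψ)) : StrongLimit l V T T' := by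
  have h' : ∀ ψ ∈ Submodule.span ℂ D, ∀ᶠ k in l, T (V k ψ) = V k (T' ψ) := fun ψ hψ => by
    induction hψ using Submodule.span_induction with
    | mem x hx => exact h x hx
    | zero => simp
    | add x y _ _ hx hy =>
      filter_upwards [hx, hy] with k h1 h2
      simp [h1, h2]
    | smul c x _ hx =>
      filter_upwards [hx] with k h1
      simp [h1]
  intro ψ
  rw [Metric.tendsto_nhds]
  intro ε hε
  have hc : (0 : ℝ) < ‖T‖ + ‖T'‖ + 1 := by positivity
  obtain ⟨φ, hφ, hd⟩ := Metric.dense_iff.1 hD ψ (ε / (‖T‖ + ‖T'‖ + 1)) (by positivity)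
  filter_upwards [h' φ hd] with k hk
  have : T (V k ψ) - V k (T' ψ) = T (V k (ψ - φ)) - V k (T' (ψ - φ)) := by
    simp only [map_sub, hk]
    abel
  rw [dist_zero_right, this]
  rw [Metric.mem_ball, dist_comm, dist_eq_norm, lt_div_iff₀ hc] at hφ
  have h1 : ‖T (V k (ψ - φ))‖ ≤ ‖T‖ * ‖ψ - φ‖ := by
    simpa only [(V k).norm_map] using T.le_opNorm (V k (ψ - φ))
  have h2 : ‖V k (T' (ψ - φ))‖ ≤ ‖T'‖ * ‖ψ - φ‖ := by
    simpa only [(V k).norm_map] using T'.le_opNorm (ψ - φ)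
  have h3 := norm_sub_le (T (V k (ψ - φ))) (V k (T' (ψ - φ)))
  nlinarith [norm_nonneg (ψ - φ)]

variable [CompleteSpace H]

/-- Strong limit of an operator together with its adjoint. -/
def StarStrongLimit (l : Filter κ) (V : κ → H →ₗᵢ[ℂ] H) (T T' : H →L[ℂ] H) : Prop :=
  StrongLimit l V T T' ∧ StrongLimit l V (star T) (star T')

namespace StarStrongLimit

theorem add (hT : StarStrongLimit l V T T') (hS : StarStrongLimit l V S S') :
    StarStrongLimit l V (T + S) (T' + S') :=
  ⟨hT.1.add hS.1, by simpa only [star_add] using hT.2.add hS.2⟩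

theorem mul (hT : StarStrongLimit l V T T') (hS : StarStrongLimit l V S S') :
    StarStrongLimit l V (T * S) (T' * S') :=
  ⟨hT.1.mul hS.1, by simpa only [star_mul] using hS.2.mul hT.2⟩

theorem algebraMap (c : ℂ) :
    StarStrongLimit l V (algebraMap ℂ (H →L[ℂ] H) c) (algebraMap ℂ (H →L[ℂ] H) c) :=
  ⟨StrongLimit.algebraMap c, by
    rw [← algebraMap_star_comm]
    exact StrongLimit.algebraMap (star c)⟩

/-- Strong convergence alone does not pass to adjoints; carrying both halves makes this immediate.
-/
theorem star (hT : StarStrongLimit l V T T') : StarStrongLimit l V (star T) (star T') :=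
  ⟨hT.2, by simpa only [star_star] using hT.1⟩

theorem sub (hT : StarStrongLimit l V T T') (hS : StarStrongLimit l V S S') :
    StarStrongLimit l V (T - S) (T' - S') := by
  have h := hT.add ((algebraMap (-1)).mul hS)
  simpa [← sub_eq_add_neg] using h

theorem unique [l.NeBot] (hT : StarStrongLimit l V T T') (hS : StarStrongLimit l V T S') :
    T' = S' := by
  have h := (hT.sub hS).1.norm_le
  rw [sub_self, norm_zero] at h
  exact sub_eq_zero.1 (norm_le_zero_iff.1 h)

theorem exists_of_mem_adjoin {x t : ι → H →L[ℂ] H} (h : ∀ j, StarStrongLimit l V (x j) (t j))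
    (hT : T ∈ StarAlgebra.adjoin ℂ (Set.range x)) :
    ∃ T' ∈ StarAlgebra.adjoin ℂ (Set.range t), StarStrongLimit l V T T' := by
  induction hT using StarAlgebra.adjoin_induction with
  | mem _ hx =>
    obtain ⟨j, rfl⟩ := hx
    exact ⟨t j, StarAlgebra.subset_adjoin ℂ _ ⟨j, rfl⟩, h j⟩
  | algebraMap c => exact ⟨_, algebraMap_mem _ c, algebraMap c⟩
  | add _ _ _ _ h1 h2 =>
    obtain ⟨a, ha, ha'⟩ := h1
    obtain ⟨b, hb, hb'⟩ := h2
    exact ⟨a + b, add_mem ha hb, ha'.add hb'⟩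
  | mul _ _ _ _ h1 h2 =>
    obtain ⟨a, ha, ha'⟩ := h1
    obtain ⟨b, hb, hb'⟩ := h2
    exact ⟨a * b, mul_mem ha hb, ha'.mul hb'⟩
  | star _ _ h1 =>
    obtain ⟨a, ha, ha'⟩ := h1
    exact ⟨_, star_mem ha, ha'.star⟩

theorem exists_of_mem_closure [l.NeBot] {x t : ι → H →L[ℂ] H}
    (h : ∀ j, StarStrongLimit l V (x j) (t j))
    (hT : T ∈ (StarAlgebra.adjoin ℂ (Set.range x)).topologicalClosure) :
    ∃ T' ∈ (StarAlgebra.adjoin ℂ (Set.range t)).topologicalClosure, StarStrongLimit l V T T' := by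
  obtain ⟨u, hu, hlim⟩ := mem_closure_iff_seq_limit.1 hT
  choose u' hu' hlim' using fun n => exists_of_mem_adjoin h (hu n)
  -- The passage to the limit is linear and contractive, so a Cauchy sequence of operators has a
  -- Cauchy sequence of limits.
  have hc : CauchySeq u' := by
    refine Metric.cauchySeq_iff.2 fun ε hε => ?_
    obtain ⟨N, hN⟩ := Metric.cauchySeq_iff.1 hlim.cauchySeq ε hε
    refine ⟨N, fun m hm n hn => lt_of_le_of_lt ?_ (hN m hm n hn)⟩
    rw [dist_eq_norm, dist_eq_norm]
    exact ((hlim' m).sub (hlim' n)).1.norm_le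
  obtain ⟨T', hT'⟩ := cauchySeq_tendsto_of_complete hc
  exact ⟨T', mem_closure_of_tendsto hT' (Eventually.of_forall hu'),
    StrongLimit.of_tendsto (fun n => (hlim' n).1) hlim hT',
    StrongLimit.of_tendsto (fun n => (hlim' n).2) hlim.star hT'.star⟩

/-- Taking strong limits is a `*`-homomorphism. -/
theorem exists_starAlgHom [l.NeBot] {x t : ι → H →L[ℂ] H}
    (h : ∀ j, StarStrongLimit l V (x j) (t j)) :
    ∃ φ : (StarAlgebra.adjoin ℂ (Set.range x)).topologicalClosure →⋆ₐ[ℂ]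
        (StarAlgebra.adjoin ℂ (Set.range t)).topologicalClosure,
      ∀ T : (StarAlgebra.adjoin ℂ (Set.range x)).topologicalClosure,
        StarStrongLimit l V (T : H →L[ℂ] H) (φ T : H →L[ℂ] H) := by
  choose φ hφ hlim using fun T : (StarAlgebra.adjoin ℂ (Set.range x)).topologicalClosure =>
    exists_of_mem_closure h T.2
  refine ⟨
    { toFun := fun T => ⟨φ T, hφ T⟩
      map_one' := Subtype.ext <| (hlim 1).unique (by simpa using algebraMap (l := l) (V := V) 1)
      map_mul' := fun S T => Subtype.ext <| (hlim _).unique ((hlim S).mul (hlim T))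
      map_zero' := Subtype.ext <| (hlim 0).unique (by simpa using algebraMap (l := l) (V := V) 0)
      map_add' := fun S T => Subtype.ext <| (hlim _).unique ((hlim S).add (hlim T))
      commutes' := fun c => Subtype.ext <| (hlim _).unique (algebraMap c)
      map_star' := fun T => Subtype.ext <| (hlim _).unique (hlim T).star }, hlim⟩

end StarStrongLimit

end AsymptoticIntertwining

/-! ### Vector potentials of constant and quarter-plane fields -/

/-- The potential at `n` only sees the sites of its column between heights `1` and `n.2`, or between
`n.2 + 1` and `0`; the field may be arbitrary elsewhere. -/
theorem potential_eq_mul {B : ℤ × ℤ → ℝ} {b : ℝ} {n : ℤ × ℤ}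
    (hpos : ∀ m : ℤ, 1 ≤ m → m ≤ n.2 → B (n.1, m) = b)
    (hneg : ∀ m : ℤ, n.2 < m → m ≤ 0 → B (n.1, m) = b) :
    potential B 0 n = b * n.2 := by
  have h1 : (0 < n.2) → ∑ m ∈ Finset.Icc 1 n.2.natAbs, B (n.1, (m : ℤ)) = b * n.2 := fun h => by
    have hs : ∀ m ∈ Finset.Icc 1 n.2.natAbs, B (n.1, (m : ℤ)) = b := fun m hm =>
      hpos m (by have := (Finset.mem_Icc.1 hm).1; omega)
        (by have := (Finset.mem_Icc.1 hm).2; omega)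
    rw [Finset.sum_congr rfl hs]
    have : ((n.2.natAbs : ℤ) : ℝ) = n.2 := by rw [Int.natAbs_of_nonneg h.le]
    rw [Finset.sum_const, Nat.card_Icc, Nat.add_sub_cancel, nsmul_eq_mul, mul_comm, ← this]
    simp
  have h2 : (n.2 < 0) → ∑ m ∈ Finset.range n.2.natAbs, B (n.1, -(m : ℤ)) = -(b * n.2) :=
      fun h => by
    have hs : ∀ m ∈ Finset.range n.2.natAbs, B (n.1, -(m : ℤ)) = b := fun m hm =>
      hneg (-m) (by have := Finset.mem_range.1 hm; omega) (by omega)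
    rw [Finset.sum_congr rfl hs]
    have : ((n.2.natAbs : ℤ) : ℝ) = -n.2 := by
      rw [Int.ofNat_natAbs_of_nonpos h.le]
      push_cast
      rfl
    rw [Finset.sum_const, Finset.card_range, nsmul_eq_mul, mul_comm, ← Int.cast_natCast, this]
    ring
  rw [potential, if_pos rfl]
  rcases lt_trichotomy n.2 0 with h | h | h
  · rw [if_neg (by omega), if_pos h, h2 h]
    ring
  · simp [h]
  · rw [if_pos h, if_neg (by omega), h1 h, sub_zero]

theorem potential_constField (b : ℝ) (n : ℤ × ℤ) : potential (constField b) 0 n = b * n.2 :=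
  potential_eq_mul (fun _ _ _ => rfl) fun _ _ _ => rfl

theorem phase_one (B : ℤ × ℤ → ℝ) (n : ℤ × ℤ) : phase B 1 n = 1 := by simp [phase, potential]

/-- The quarter plane `n₁, n₂ ≥ 1`. -/
def quadrant : Set (ℤ × ℤ) := {n | ¬ (n.1 ≤ 0 ∨ n.2 ≤ 0)}

theorem mem_quadrant {n : ℤ × ℤ} : n ∈ quadrant ↔ 1 ≤ n.1 ∧ 1 ≤ n.2 := by
  rw [quadrant, Set.mem_ofPred_eq]
  omega

/-- The sum starts at height `1`, exactly where the quarter plane starts, so the phases agree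
exactly and no gauge correction is needed. -/
theorem phase_quarterField_of_mem (bq bs : ℝ) (j : Fin 2) {n : ℤ × ℤ} (hn : n ∈ quadrant) :
    phase (quarterField bq bs) j n = phase (constField bq) j n := by
  rw [mem_quadrant] at hn
  fin_cases j
  · have : potential (quarterField bq bs) 0 n = bq * n.2 := by
      refine potential_eq_mul (fun m h _ => ?_) fun m _ _ => ?_
      · exact if_neg (by simp only; omega)
      · omega
    simp [phase, this, potential_constField]
  · exact (phase_one _ n).trans (phase_one _ n).symm

theorem phase_quarterField_of_notMem (bq bs : ℝ) (j : Fin 2) {n : ℤ × ℤ} (hn : n ∉ quadrant) :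
    phase (quarterField bq bs) j n = phase (constField bs) j n := by
  rw [mem_quadrant] at hn
  fin_cases j
  · have : potential (quarterField bq bs) 0 n = bs * n.2 := by
      refine potential_eq_mul (fun m _ _ => ?_) fun m _ _ => ?_
      · exact if_pos (by simp only; omega)
      · exact if_pos (by simp only; omega)
    simp [phase, this, potential_constField]
  · exact (phase_one _ n).trans (phase_one _ n).symm

/-! ### Diagonal translations to infinity -/

theorem norm_map_of_star_mul_self {W : BdOp} (hW : star W * W = 1) (ψ : Hil) : ‖W ψ‖ = ‖ψ‖ :=
  (ContinuousLinearMap.norm_map_iff_adjoint_comp_self W).2 hW ψ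

/-- The phase `exp(i b k n₁)`. -/
def dualPhase (b : ℝ) (k : ℤ) : ℓ^∞(ℤ × ℤ, ℂ) :=
  bddFun (fun n => Complex.exp (Complex.I * ((b * k * n.1 : ℝ) : ℂ)))
    (fun n => by rw [Complex.norm_exp_I_mul_ofReal])

theorem dualPhase_mul_star (b : ℝ) (k : ℤ) (n : ℤ × ℤ) :
    dualPhase b k n * star (dualPhase b k n) = 1 := by
  have h : ‖dualPhase b k n‖ = 1 := Complex.norm_exp_I_mul_ofReal _
  have := Complex.mul_conj' (dualPhase b k n)
  rw [h] at this
  simpa using this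

/-- The translation by `(k, k)`, with the phase that makes it commute with the magnetic
translations of the constant field `b`. -/
def diagTrans (b : ℝ) (k : ℤ) : Hil →ₗᵢ[ℂ] Hil where
  toLinearMap := (weightedShift (dualPhase b k) (k, k)).toLinearMap
  norm_map' := norm_map_of_star_mul_self <| by
    ext ψ n
    have h := dualPhase_mul_star b k (n + (k, k))
    simp only [mul_apply_eq_comp, star_weightedShift_apply, weightedShift_apply,
      add_sub_cancel_right, one_apply_eq_self]
    linear_combination ψ n * h

theorem diagTrans_apply (b : ℝ) (k : ℤ) (ψ : Hil) (n : ℤ × ℤ) :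
    diagTrans b k ψ n = dualPhase b k n * ψ (n - (k, k)) := rfl

/-- Translation by `(k, k)` changes the potential `b * n.2` by `-b * k`, and the increment of `b * k
* n.1` in the first direction compensates it. -/
theorem phase_mul_dualPhase (b : ℝ) (k : ℤ) (j : Fin 2) (n : ℤ × ℤ) :
    phase (constField b) j n * dualPhase b k (n - e j) =
      dualPhase b k n * phase (constField b) j (n - (k, k)) := by
  fin_cases j
  · simp only [phase, dualPhase, bddFun_apply, ← Complex.exp_add, Fin.zero_eta,
      potential_constField, e, Matrix.cons_val_zero, Prod.fst_sub, Prod.snd_sub]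
    congr 1
    push_cast
    ring
  · simp [phase_one, dualPhase, e]

theorem dense_span_single :
    Dense (Submodule.span ℂ (Set.range fun m : ℤ × ℤ => (lp.single 2 m (1 : ℂ) : Hil)) :
      Set Hil) := by
  intro ψ
  have h : HasSum (fun i => (lp.single 2 i (ψ i) : Hil)) ψ :=
    lp.hasSum_single (by norm_num) ψ
  refine mem_closure_of_tendsto h (Eventually.of_forall fun s => sum_mem fun i _ => ?_)
  have : (lp.single 2 i (ψ i) : Hil) = ψ i • lp.single 2 i (1 : ℂ) := by
    rw [← lp.single_smul, smul_eq_mul, mul_one]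
  rw [this]
  exact Submodule.smul_mem _ _ (Submodule.subset_span ⟨i, rfl⟩)

/-- On a basis vector only one phase enters, so the intertwining is exact for all `k` far enough
along `l`. -/
theorem starStrongLimit_magTrans {B : ℤ × ℤ → ℝ} {b : ℝ} {l : Filter ℤ}
    (h : ∀ j m, ∀ᶠ k in l, phase B j (m + (k, k)) = phase (constField b) j (m + (k, k)))
    (j : Fin 2) :
    StarStrongLimit l (diagTrans b) (magTrans B j) (magTrans (constField b) j) := by
  constructor
  · refine StrongLimit.of_dense dense_span_single ?_
    rintro _ ⟨m, rfl⟩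
    -- The translation moves the basis vector from `m + (k, k)` to `m + e j + (k, k)`, and the phase
    -- is read at the target; the adjoint reads it at the source.
    filter_upwards [h j (m + e j)] with k hk
    ext n
    simp only [magTrans, weightedShift_apply, diagTrans_apply]
    have h1 := phase_mul_dualPhase b k j n
    rw [sub_right_comm n (e j)]
    by_cases hn : n - (k, k) - e j = m
    · obtain rfl : n = m + e j + (k, k) := by rw [← hn]; abel
      rw [hk, ← mul_assoc, h1, mul_assoc]
    · rw [lp.single_apply_ne _ _ _ hn]
      simp
  · refine StrongLimit.of_dense dense_span_single ?_
    rintro _ ⟨m, rfl⟩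
    filter_upwards [h j m] with k hk
    ext n
    simp only [magTrans, star_weightedShift_apply, diagTrans_apply]
    have h1 := phase_mul_dualPhase b k j (n + e j)
    have h2 := phase_mul_star (constField b) j (n + e j)
    have h3 := phase_mul_star (constField b) j (n - (k, k) + e j)
    rw [add_sub_cancel_right] at h1
    rw [add_sub_right_comm] at h1 ⊢
    by_cases hn : n - (k, k) + e j = m
    · have hn' : n + e j = m + (k, k) := by rw [← hn]; abel
      rw [← hn'] at hk
      rw [hk]
      generalize (lp.single 2 m (1 : ℂ) : Hil) (n - (k, k) + e j) = z
      -- This is `h1` multiplied by both conjugate phases, which cancel by unimodularity.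
      linear_combination (star (phase (constField b) j (n + e j)) *
        star (phase (constField b) j (n - (k, k) + e j)) * z) * (-h1) +
        dualPhase b k n * star (phase (constField b) j (n - (k, k) + e j)) * z * h2 -
        dualPhase b k (n + e j) * star (phase (constField b) j (n + e j)) * z * h3
    · rw [lp.single_apply_ne _ _ _ hn]
      simp

/-! ### The evaluation homomorphisms -/

/-- As an instance, this closedness lets the subalgebra inherit its C⋆-structure. -/
instance isClosed_magAlg (B : ℤ × ℤ → ℝ) : IsClosed (magAlg B : Set BdOp) :=
  StarSubalgebra.isClosed_topologicalClosure _

theorem continuous_starAlgHom {A A' : Type*} [CStarAlgebra A] [CStarAlgebra A']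
    (φ : A →⋆ₐ[ℂ] A') : Continuous φ :=
  AddMonoidHomClass.continuous_of_bound φ 1 fun x => by
    simpa using NonUnitalStarAlgHom.norm_apply_le φ x

theorem exists_evaluation {B : ℤ × ℤ → ℝ} {b : ℝ} {l : Filter ℤ} [l.NeBot]
    (h : ∀ j m, ∀ᶠ k in l, phase B j (m + (k, k)) = phase (constField b) j (m + (k, k))) :
    ∃ φ : magAlg B →⋆ₐ[ℂ] magAlg (constField b), ∀ j, φ (s B j) = s (constField b) j := by
  obtain ⟨φ, hφ⟩ := StarStrongLimit.exists_starAlgHom (starStrongLimit_magTrans h)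
  exact ⟨φ, fun j => Subtype.ext ((hφ (s B j)).unique (starStrongLimit_magTrans h j))⟩

theorem exists_evaluation_quadrant (bq bs : ℝ) :
    ∃ φ : QPAlg bq bs →⋆ₐ[ℂ] magAlg (constField bq),
      ∀ j, φ (s (quarterField bq bs) j) = s (constField bq) j := by
  refine exists_evaluation (l := atTop) fun j m => ?_
  filter_upwards [eventually_ge_atTop (1 - m.1), eventually_ge_atTop (1 - m.2)] with k h1 h2
  refine phase_quarterField_of_mem _ _ _ (mem_quadrant.2 ⟨?_, ?_⟩)
  · rw [Prod.fst_add]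
    omega
  · rw [Prod.snd_add]
    omega

theorem exists_evaluation_compl_quadrant (bq bs : ℝ) :
    ∃ φ : QPAlg bq bs →⋆ₐ[ℂ] magAlg (constField bs),
      ∀ j, φ (s (quarterField bq bs) j) = s (constField bs) j := by
  refine exists_evaluation (l := atBot) fun j m => ?_
  -- A nonpositive first coordinate already places the site outside the quarter plane.
  filter_upwards [eventually_le_atBot (-m.1)] with k h1
  refine phase_quarterField_of_notMem _ _ _ fun hm => ?_
  have := (mem_quadrant.1 hm).1
  rw [Prod.fst_add] at this
  omega

/-! ### Compressions by a projection -/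

section Corner

variable {R ι : Type*} [CStarAlgebra R]

/-- To prove that the C⋆-algebra generated by the `x j` lies in a closed subspace it suffices to
find a subset of the subspace that contains `1` and is stable under left multiplication by the
generators and their adjoints. -/
theorem mem_of_mem_closure_adjoin {x : ι → R} {C : Set R} (one : 1 ∈ C)
    (mul_left : ∀ j, ∀ T ∈ C, x j * T ∈ C) (star_mul_left : ∀ j, ∀ T ∈ C, star (x j) * T ∈ C)
    {M : Submodule ℂ R} (hM : IsClosed (M : Set R)) (hC : C ⊆ M) {T : R}
    (hT : T ∈ (StarAlgebra.adjoin ℂ (Set.range x)).topologicalClosure) : T ∈ M := by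
  refine closure_minimal (fun T hT => ?_) hM hT
  have hT' : T ∈ Subalgebra.toSubmodule (StarAlgebra.adjoin ℂ (Set.range x)).toSubalgebra := hT
  rw [StarAlgebra.adjoin_eq_span] at hT'
  refine Submodule.span_le.2 (fun w hw => hC ?_) hT'
  refine Submonoid.closure_induction_left (motive := fun w _ => w ∈ C) one ?_ hw
  rintro y (⟨j, rfl⟩ | ⟨j, hj⟩) T - hT
  · exact mul_left j T hT
  · rw [← star_star y, ← hj]
    exact star_mul_left j T hT

/-- Commutation up to a nonzero scalar. -/
def QuasiCommute (a b : R) : Prop := ∃ c : ℂ, c ≠ 0 ∧ a * b = c • (b * a)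

theorem QuasiCommute.refl (a : R) : QuasiCommute a a := ⟨1, one_ne_zero, (one_smul _ _).symm⟩

theorem QuasiCommute.symm {a b : R} (h : QuasiCommute a b) : QuasiCommute b a := by
  obtain ⟨c, hc, h⟩ := h
  exact ⟨c⁻¹, inv_ne_zero hc, by rw [h, smul_smul, inv_mul_cancel₀ hc, one_smul]⟩

theorem QuasiCommute.star_left {a b : R} (h : QuasiCommute a b) (h1 : star a * a = 1)
    (h2 : a * star a = 1) : QuasiCommute (star a) b := by
  obtain ⟨c, hc, h⟩ := h
  refine ⟨c⁻¹, inv_ne_zero hc, ?_⟩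
  have : b * star a = c • (star a * b) := by
    calc b * star a = star a * (a * b) * star a := by rw [← mul_assoc (star a), h1, one_mul]
      _ = c • (star a * b) := by
        rw [h, mul_smul_comm, smul_mul_assoc, ← mul_assoc (star a), mul_assoc _ a, h2, mul_one]
  rw [this, smul_smul, inv_mul_cancel₀ hc, one_smul]

theorem QuasiCommute.star_star {a b : R} (h : QuasiCommute a b) (ha : star a * a = 1)
    (ha' : a * star a = 1) (hb : star b * b = 1) (hb' : b * star b = 1) :
    QuasiCommute (star a) (star b) :=
  ((h.star_left ha ha').symm.star_left hb hb').symm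

/-- A projection `Q` compressing the unitaries `t j` to the elements `x j` in the same way as a
projection onto a subset of a lattice which is stable under the translations. -/
structure IsCompression (x t : ι → R) (Q : R) : Prop where
  star_eq : star Q = Q
  mul_self : Q * Q = Q
  mul_eq : ∀ j, Q * t j = Q * x j
  mul_mul : ∀ j, Q * x j * Q = Q * x j

namespace IsCompression

variable {x t : ι → R} {Q : R} {A N : StarSubalgebra ℂ R}

theorem star_mul_eq (h : IsCompression x t Q) (j : ι) : star (t j) * Q = star (x j) * Q := by
  simpa only [star_mul, h.star_eq] using congrArg star (h.mul_eq j)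

theorem mul_star_mul (h : IsCompression x t Q) (j : ι) : Q * star (x j) * Q = star (x j) * Q := by
  simpa only [star_mul, h.star_eq, mul_assoc] using congrArg star (h.mul_mul j)

/-- If the `t j` commute up to scalars, then compressions of elements of `C*(t)` belong to any
C⋆-algebra that contains `Q` and the `x j`. -/
theorem corner_mem (h : IsCompression x t Q) (hA : IsClosed (A : Set R)) (hQ : Q ∈ A)
    (hx : ∀ j, x j ∈ A) (hc : ∀ i j, QuasiCommute (star (t i)) (t j))
    (hc' : ∀ i j, QuasiCommute (star (t i)) (star (t j))) {T : R}
    (hT : T ∈ (StarAlgebra.adjoin ℂ (Set.range t)).topologicalClosure) : Q * T * Q ∈ A := by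
  let M : Submodule ℂ R := (Subalgebra.toSubmodule A.toSubalgebra).comap
    (LinearMap.mulRight ℂ Q ∘ₗ LinearMap.mulLeft ℂ Q)
  have hM : IsClosed (M : Set R) :=
    hA.preimage (show Continuous fun T => Q * T * Q by fun_prop)
  refine mem_of_mem_closure_adjoin (M := M)
    -- The second condition makes it possible to move `star (t i)` across `T` in the adjoint step.
    (C := {T | Q * T * Q ∈ A ∧ ∀ i, ∃ c : ℂ, star (t i) * T = c • (T * star (t i))})
    ⟨by simpa [h.mul_self] using hQ, fun i => ⟨1, by simp⟩⟩ ?_ ?_ hM (fun T hT => hT.1) hT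
  · rintro j T ⟨hT, hTc⟩
    refine ⟨?_, fun i => ?_⟩
    · have : Q * (t j * T) * Q = Q * x j * (Q * T * Q) := by
        rw [← mul_assoc Q, h.mul_eq, ← h.mul_mul]
        simp only [← mul_assoc]
        rw [mul_assoc (Q * x j) Q Q, h.mul_self]
      rw [this]
      exact mul_mem (mul_mem hQ (hx j)) hT
    · obtain ⟨c, hT⟩ := hTc i
      obtain ⟨d, -, hd⟩ := hc i j
      exact ⟨d * c, by
        rw [← mul_assoc, hd, smul_mul_assoc, mul_assoc, hT, mul_smul_comm, smul_smul, mul_assoc]⟩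
  · rintro j T ⟨hT, hTc⟩
    refine ⟨?_, fun i => ?_⟩
    · obtain ⟨c, hTj⟩ := hTc j
      -- Next to the left `Q` the factor `star (t j)` cannot be replaced by `star (x j)`, so it is
      -- moved to the right end, where `star_mul_eq` applies.
      have : Q * (star (t j) * T) * Q = c • (Q * T * Q * (star (x j) * Q)) := by
        rw [hTj, ← h.mul_star_mul, mul_smul_comm, smul_mul_assoc, mul_assoc, mul_assoc T,
          h.star_mul_eq, ← h.mul_star_mul]
        congr 1
        simp only [← mul_assoc]
        rw [mul_assoc (Q * T) Q Q, h.mul_self]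
      rw [this]
      exact A.smul_mem (mul_mem hT (mul_mem (star_mem (hx j)) hQ)) c
    · obtain ⟨c, hT⟩ := hTc i
      obtain ⟨d, -, hd⟩ := hc' i j
      exact ⟨d * c, by
        rw [← mul_assoc, hd, smul_mul_assoc, mul_assoc, hT, mul_smul_comm, smul_smul, mul_assoc]⟩

/-- The compression by `Q` as a linear map. -/
def cornerMap (Q : R) (A N : StarSubalgebra ℂ R) (h : ∀ T ∈ N, Q * T * Q ∈ A) : N →ₗ[ℂ] A where
  toFun T := ⟨Q * T * Q, h T T.2⟩
  map_add' S T := Subtype.ext <| by simp [mul_add, add_mul]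
  map_smul' c T := Subtype.ext <| by simp

@[simp]
theorem coe_cornerMap (h : ∀ T ∈ N, Q * T * Q ∈ A) (T : N) :
    (cornerMap Q A N h T : R) = Q * T * Q := rfl

theorem continuous_cornerMap (h : ∀ T ∈ N, Q * T * Q ∈ A) : Continuous (cornerMap Q A N h) :=
  Continuous.subtype_mk (by fun_prop) _

/-- If the commutators of `Q` with the generators of `C*(x)` belong to a closed ideal `J`, then
`y Q` agrees modulo `J` with the compression of the image of `y` under a homomorphism mapping
`x j` to `t j`. -/
theorem mul_sub_cornerMap_mem (h : IsCompression x t Q) (hcorner : ∀ T ∈ N, Q * T * Q ∈ A)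
    (hAc : IsClosed (A : Set R))
    (hA : A ≤ (StarAlgebra.adjoin ℂ (Set.range x)).topologicalClosure) (hx : ∀ j, x j ∈ A)
    (ht : ∀ j, t j ∈ N) (hunit : ∀ j, t j * star (t j) = 1) (hunit' : ∀ j, star (x j) * x j = 1)
    (hQ : Q ∈ A) {φ : A →⋆ₐ[ℂ] N} (hφc : Continuous φ) (hφ : ∀ j, φ ⟨x j, hx j⟩ = ⟨t j, ht j⟩)
    {J : Submodule ℂ A} (hJ : IsClosed (J : Set A)) (hJl : ∀ a, ∀ y ∈ J, a * y ∈ J)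
    (hJr : ∀ a, ∀ y ∈ J, y * a ∈ J)
    (hcomm : ∀ j, (⟨x j, hx j⟩ * ⟨Q, hQ⟩ - ⟨Q, hQ⟩ * ⟨x j, hx j⟩ : A) ∈ J) (y : A) :
    y * ⟨Q, hQ⟩ - cornerMap Q A N hcorner (φ y) ∈ J := by
  let κ := cornerMap Q A N hcorner
  let q : A := ⟨Q, hQ⟩
  let g : A →ₗ[ℂ] A := LinearMap.mulRight ℂ q - κ ∘ₗ φ.toAlgHom.toLinearMap
  have hg : Continuous g := by
    have h1 : Continuous fun y : A => y * q - κ (φ y) :=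
      (continuous_id.mul continuous_const).sub ((continuous_cornerMap hcorner).comp hφc)
    exact h1
  have hgJ : ∀ y : A, y ∈ J.comap g ↔ y * q - κ (φ y) ∈ J := fun y => Iff.rfl
  -- The word induction concerns subspaces of `R`, so the subspace of good `y` is pushed forward; it
  -- stays closed because `A` is closed.
  let M : Submodule ℂ R := (J.comap g).map A.toSubalgebra.val.toLinearMap
  have hM : IsClosed (M : Set R) :=
    hAc.isClosedEmbedding_subtypeVal.isClosedMap _ (hJ.preimage hg)
  have hmem : (y : R) ∈ M := by
    refine mem_of_mem_closure_adjoin (C := M) ?_ ?_ ?_ hM subset_rfl (hA y.2)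
    · refine ⟨1, (hgJ 1).2 ?_, rfl⟩
      have : (1 : A) * q - κ (φ 1) = 0 := Subtype.ext <| by
        simp [q, κ, h.mul_self]
      rw [this]
      exact zero_mem J
    · rintro j _ ⟨T, hT, rfl⟩
      have hT := (hgJ T).1 hT
      let X : A := ⟨x j, hx j⟩
      refine ⟨X * T, (hgJ _).2 ?_, rfl⟩
      have hmul : φ (X * T) = ⟨t j, ht j⟩ * φ T := by rw [map_mul, hφ]
      have : X * T * q - κ (φ (X * T)) =
          X * (T * q - κ (φ T)) + (X * q - q * X) * κ (φ T) := Subtype.ext <| by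
        have h1 : Q * (t j * (φ T : R)) * Q = Q * (x j * (Q * ((φ T : R) * Q))) := by
          simp only [← mul_assoc]
          rw [h.mul_eq, h.mul_mul]
        have h2 : Q * (Q * ((φ T : R) * Q)) = Q * ((φ T : R) * Q) := by
          rw [← mul_assoc, h.mul_self]
        simp only [hmul, X, q, κ, coe_cornerMap, AddSubgroupClass.coe_sub, MulMemClass.coe_mul,
          AddMemClass.coe_add, h1, mul_sub, sub_mul, mul_assoc, h2]
        abel
      rw [this]
      exact add_mem (hJl _ _ hT) (hJr _ _ (hcomm j))
    · rintro j _ ⟨T, hT, rfl⟩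
      have hT := (hgJ T).1 hT
      let X : A := ⟨x j, hx j⟩
      refine ⟨star X * T, (hgJ _).2 ?_, rfl⟩
      -- Writing `φ T = t j * T'` brings in `t j`, which `Q` can absorb, and needs only the
      -- commutator with `x j`, not with its adjoint.
      let T' := star (⟨t j, ht j⟩ : N) * φ T
      have hmul : φ (star X * T) = T' := by rw [map_mul, map_star, hφ]
      have hTT : (φ T : R) = t j * (T' : R) := by
        simp only [T', MulMemClass.coe_mul, StarMemClass.coe_star]
        rw [← mul_assoc, hunit, one_mul]
      have : star X * T * q - κ (φ (star X * T)) =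
          star X * (T * q - κ (φ T)) - star X * (X * q - q * X) * κ T' := Subtype.ext <| by
        have h1 : Q * (φ T : R) * Q = Q * (x j * (Q * ((T' : R) * Q))) := by
          rw [hTT]
          simp only [← mul_assoc]
          rw [h.mul_eq, h.mul_mul]
        have h2 : Q * (Q * ((T' : R) * Q)) = Q * ((T' : R) * Q) := by
          rw [← mul_assoc, h.mul_self]
        have h3 : star (x j) * (x j * (Q * ((T' : R) * Q))) = Q * ((T' : R) * Q) := by
          rw [← mul_assoc, hunit', one_mul]
        simp only [hmul, X, q, κ, coe_cornerMap, AddSubgroupClass.coe_sub, MulMemClass.coe_mul,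
          StarMemClass.coe_star, h1, mul_sub, sub_mul, mul_assoc, h2, h3]
        abel
      rw [this]
      exact sub_mem (hJl _ _ hT) (hJr _ _ (hJl _ _ (hcomm j)))
  obtain ⟨z, hz, hzy⟩ := hmem
  obtain rfl : z = y := Subtype.ext hzy
  exact (hgJ z).1 hz

end IsCompression

end Corner

/-! ### Closed two-sided ideals of C⋆-algebras -/

section ClosedIdeal

variable {A : Type*} [CStarAlgebra A] {S : Set A} {x y : A}

theorem closedIdeal_mul_left (a : A) (hx : x ∈ closedIdeal S) : a * x ∈ closedIdeal S :=
  map_mem_closure (continuous_const_mul a) hx fun _ h => TwoSidedIdeal.mul_mem_left _ _ _ h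

theorem closedIdeal_mul_right (a : A) (hx : x ∈ closedIdeal S) : x * a ∈ closedIdeal S :=
  map_mem_closure (f := (· * a)) (continuous_mul_const a) hx fun _ h =>
    TwoSidedIdeal.mul_mem_right _ _ _ h

theorem subset_closedIdeal : S ⊆ closedIdeal S :=
  fun _ h => subset_closure (TwoSidedIdeal.subset_span h)

/-- The closed two-sided ideal generated by `S` as a subspace. -/
def closedIdealSubmodule (S : Set A) : Submodule ℂ A where
  carrier := closedIdeal S
  zero_mem' := subset_closure (TwoSidedIdeal.zero_mem _)
  add_mem' hx hy := map_mem_closure₂ continuous_add hx hy fun _ h _ h' =>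
    TwoSidedIdeal.add_mem _ h h'
  smul_mem' c x hx := by
    rw [← one_mul x, ← smul_mul_assoc]
    exact closedIdeal_mul_left _ hx

theorem closedIdeal_subset_ker {A' : Type*} [CStarAlgebra A'] {φ : A →⋆ₐ[ℂ] A'}
    (h : ∀ x ∈ S, φ x = 0) : closedIdeal S ⊆ TwoSidedIdeal.ker φ := by
  have hc : IsClosed (TwoSidedIdeal.ker φ : Set A) := by
    have : (TwoSidedIdeal.ker φ : Set A) = φ ⁻¹' {0} := by
      ext x
      simp [TwoSidedIdeal.mem_ker]
    rw [this]
    exact isClosed_singleton.preimage (continuous_starAlgHom φ)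
  exact closure_minimal
    (TwoSidedIdeal.span_le.2 fun x hx => (TwoSidedIdeal.mem_ker φ).2 (h x hx)) hc

end ClosedIdeal

/-! ### Relations in the magnetic algebras -/

theorem star_magTrans_mul_self (B : ℤ × ℤ → ℝ) (j : Fin 2) :
    star (magTrans B j) * magTrans B j = 1 := by
  ext ψ n
  have h := phase_mul_star B j (n + e j)
  simp only [magTrans, mul_apply_eq_comp, star_weightedShift_apply, weightedShift_apply,
    add_sub_cancel_right, one_apply_eq_self]
  linear_combination ψ n * h

theorem magTrans_mul_star_self (B : ℤ × ℤ → ℝ) (j : Fin 2) :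
    magTrans B j * star (magTrans B j) = 1 := by
  ext ψ n
  have h := phase_mul_star B j n
  simp only [magTrans, mul_apply_eq_comp, star_weightedShift_apply, weightedShift_apply,
    sub_add_cancel, one_apply_eq_self]
  linear_combination ψ n * h

theorem s_mul_star_self (B : ℤ × ℤ → ℝ) (j : Fin 2) : s B j * star (s B j) = 1 :=
  Subtype.ext (magTrans_mul_star_self B j)

theorem star_s_mul_self (B : ℤ × ℤ → ℝ) (j : Fin 2) : star (s B j) * s B j = 1 :=
  Subtype.ext (star_magTrans_mul_self B j)

theorem f_eq (B : ℤ × ℤ → ℝ) : f B = s B 0 * s B 1 * star (s B 0) * star (s B 1) :=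
  Subtype.ext (magTrans_comm B).symm

theorem flux_constField (b : ℝ) :
    flux (constField b) = Complex.exp (Complex.I * b) • (1 : BdOp) := by
  ext ψ n
  simp [flux, fluxFun, constField]

theorem f_constField (b : ℝ) : f (constField b) = Complex.exp (Complex.I * b) • 1 :=
  Subtype.ext (flux_constField b)

/-- For a constant field the group commutator of the two translations is the flux, a nonzero scalar.
-/
theorem quasiCommute_magTrans (b : ℝ) (i j : Fin 2) :
    QuasiCommute (magTrans (constField b) i) (magTrans (constField b) j) := by
  have h : QuasiCommute (magTrans (constField b) 0) (magTrans (constField b) 1) := by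
    refine ⟨Complex.exp (Complex.I * b), Complex.exp_ne_zero _, ?_⟩
    have h1 : magTrans (constField b) 0 * magTrans (constField b) 1 =
        magTrans (constField b) 0 * magTrans (constField b) 1 * star (magTrans (constField b) 0) *
          star (magTrans (constField b) 1) *
          (magTrans (constField b) 1 * magTrans (constField b) 0) := by
      rw [← mul_assoc, mul_assoc _ (star (magTrans (constField b) 1)), star_magTrans_mul_self,
        mul_one, mul_assoc _ (star (magTrans (constField b) 0)), star_magTrans_mul_self, mul_one]
    rw [magTrans_comm, flux_constField, smul_mul_assoc, one_mul] at h1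
    exact h1
  fin_cases i <;> fin_cases j
  · exact .refl _
  · exact h
  · exact h.symm
  · exact .refl _

/-! ### The projection onto the quarter plane -/

/-- The projection onto the quarter plane. -/
def projQuadrant : BdOp := mulOp (charFun quadrant)

theorem charFun_apply_of_mem {O : Set (ℤ × ℤ)} {n : ℤ × ℤ} (h : n ∈ O) : charFun O n = 1 := by
  simp [charFun, h]

theorem charFun_apply_of_notMem {O : Set (ℤ × ℤ)} {n : ℤ × ℤ} (h : n ∉ O) : charFun O n = 0 := by
  simp [charFun, h]

theorem projQuadrant_apply (ψ : Hil) (n : ℤ × ℤ) :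
    projQuadrant ψ n = charFun quadrant n * ψ n := mulOp_apply _ _ _

/-- The flux takes two distinct values, one on the quarter plane and one off it, so an affine
function of it is the indicator. -/
theorem projQuadrant_eq {bq bs : ℝ} (h : ∀ k : ℤ, bq - bs ≠ 2 * Real.pi * k) :
    projQuadrant = (Complex.exp (Complex.I * bq) - Complex.exp (Complex.I * bs))⁻¹ •
      (flux (quarterField bq bs) - Complex.exp (Complex.I * bs) • 1) := by
  have hne := exp_sub_ne_zero h
  ext ψ n
  rw [smul_apply, sub_apply, lp.coeFn_smul, Pi.smul_apply, lp.coeFn_sub, Pi.sub_apply,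
    smul_eq_mul, eq_inv_mul_iff_mul_eq₀ hne, flux, mulOp_apply, projQuadrant_apply, smul_apply,
    one_apply_eq_self, lp.coeFn_smul, Pi.smul_apply, smul_eq_mul, fluxFun, bddFun_apply]
  by_cases hn : n ∈ quadrant
  · rw [charFun_apply_of_mem hn, quarterField, if_neg hn]
    ring
  · rw [charFun_apply_of_notMem hn, quarterField, if_pos (not_not.1 hn)]
    ring

theorem projQuadrant_mem {bq bs : ℝ} (h : ∀ k : ℤ, bq - bs ≠ 2 * Real.pi * k) :
    projQuadrant ∈ magAlg (quarterField bq bs) := by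
  rw [projQuadrant_eq h]
  exact SMulMemClass.smul_mem _ (sub_mem (flux_mem _) (SMulMemClass.smul_mem _ (one_mem _)))

theorem star_projQuadrant : star projQuadrant = projQuadrant := by
  ext ψ n
  rw [projQuadrant, mulOp, star_weightedShift_apply, weightedShift_apply, add_zero, sub_zero]
  by_cases hn : n ∈ quadrant
  · simp [charFun_apply_of_mem hn]
  · simp [charFun_apply_of_notMem hn]

theorem projQuadrant_mul_self : projQuadrant * projQuadrant = projQuadrant := by
  ext ψ n
  simp only [mul_apply_eq_comp, projQuadrant_apply]
  by_cases hn : n ∈ quadrant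
  · simp [charFun_apply_of_mem hn]
  · simp [charFun_apply_of_notMem hn]

/-- The quarter plane is stable under `n ↦ n + e j`, the shift performed by the adjoints; hence
adjoints serve as generators here. The complement is stable under `n ↦ n - e j` and uses the
translations themselves. -/
theorem isCompression_projQuadrant (bq bs : ℝ) :
    IsCompression (fun j => star (magTrans (quarterField bq bs) j))
      (fun j => star (magTrans (constField bq) j)) projQuadrant where
  star_eq := star_projQuadrant
  mul_self := projQuadrant_mul_self
  mul_eq j := by
    ext ψ n
    simp only [mul_apply_eq_comp, projQuadrant_apply, magTrans, star_weightedShift_apply]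
    by_cases hn : n ∈ quadrant
    · rw [phase_quarterField_of_mem]
      rw [mem_quadrant] at hn ⊢
      fin_cases j <;> simp [e] <;> omega
    · simp [charFun_apply_of_notMem hn]
  mul_mul j := by
    ext ψ n
    simp only [mul_apply_eq_comp, projQuadrant_apply, magTrans, star_weightedShift_apply]
    by_cases hn : n ∈ quadrant
    · have : n + e j ∈ quadrant := by
        rw [mem_quadrant] at hn ⊢
        fin_cases j <;> simp [e] <;> omega
      rw [charFun_apply_of_mem this, one_mul]
    · simp [charFun_apply_of_notMem hn]

theorem one_sub_projQuadrant_apply (ψ : Hil) (n : ℤ × ℤ) :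
    (1 - projQuadrant) ψ n = (1 - charFun quadrant n) * ψ n := by
  rw [sub_apply, lp.coeFn_sub, Pi.sub_apply, projQuadrant_apply, one_apply_eq_self, sub_mul,
    one_mul]

theorem isCompression_one_sub_projQuadrant (bq bs : ℝ) :
    IsCompression (magTrans (quarterField bq bs)) (magTrans (constField bs))
      (1 - projQuadrant) where
  star_eq := by rw [star_sub, star_one, star_projQuadrant]
  mul_self := by
    rw [sub_mul, one_mul, mul_sub, mul_one, projQuadrant_mul_self, sub_self, sub_zero]
  mul_eq j := by
    ext ψ n
    simp only [mul_apply_eq_comp, one_sub_projQuadrant_apply, magTrans, weightedShift_apply]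
    by_cases hn : n ∈ quadrant
    · simp [charFun_apply_of_mem hn]
    · rw [phase_quarterField_of_notMem _ _ _ hn]
  mul_mul j := by
    ext ψ n
    simp only [mul_apply_eq_comp, one_sub_projQuadrant_apply, magTrans, weightedShift_apply]
    by_cases hn : n ∈ quadrant
    · simp [charFun_apply_of_mem hn]
    · have : n - e j ∉ quadrant := by
        rw [mem_quadrant] at hn ⊢
        fin_cases j <;> simp [e] <;> omega
      rw [charFun_apply_of_notMem this, sub_zero, one_mul]

theorem magTrans_conj_mulOp_apply (B : ℤ × ℤ → ℝ) (j : Fin 2) (g : ℓ^∞(ℤ × ℤ, ℂ)) (ψ : Hil)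
    (n : ℤ × ℤ) : (magTrans B j * mulOp g * star (magTrans B j)) ψ n = g (n - e j) * ψ n := by
  have h := phase_mul_star B j n
  simp only [magTrans, mul_apply_eq_comp, star_weightedShift_apply, mulOp_apply,
    weightedShift_apply, sub_add_cancel]
  linear_combination g (n - e j) * ψ n * h

theorem mem_rightHalfLine_zero {n : ℤ × ℤ} : n ∈ rightHalfLine 0 ↔ 0 ≤ n.1 ∧ n.2 = 0 := by
  obtain ⟨a, b⟩ := n
  simp only [rightHalfLine, e, Set.mem_ofPred_eq, zero_add, Matrix.cons_val_zero, Prod.smul_mk,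
    Prod.mk.injEq, nsmul_eq_mul, mul_one, mul_zero, exists_and_right]
  exact and_congr_left' ⟨fun ⟨j, h⟩ => by omega, fun h => ⟨a.natAbs, by omega⟩⟩

theorem mem_upHalfLine_zero {n : ℤ × ℤ} : n ∈ upHalfLine 0 ↔ n.1 = 0 ∧ 0 ≤ n.2 := by
  obtain ⟨a, b⟩ := n
  simp only [upHalfLine, e, Set.mem_ofPred_eq, zero_add, Matrix.cons_val_one, Prod.smul_mk,
    Prod.mk.injEq, nsmul_eq_mul, mul_one, mul_zero, exists_and_left, Matrix.cons_val_fin_one]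
  exact and_congr_right' ⟨fun ⟨j, h⟩ => by omega, fun h => ⟨b.natAbs, by omega⟩⟩

/-- The commutator measures how the indicator changes under a shift by `e i`, and this is supported
on one boundary line of the quarter plane. That line starts at height or abscissa `1`; conjugation
by the other translation accounts for the offset from a half-line at the origin. -/
theorem commutator_projQuadrant_of_charFun (B : ℤ × ℤ → ℝ) (i j : Fin 2) (O : Set (ℤ × ℤ))
    (h1 : ∀ n, n - e i ∈ quadrant → n ∈ quadrant)
    (h2 : ∀ n, n - e i - e j ∈ O ↔ n ∈ quadrant ∧ n - e i ∉ quadrant) :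
    projQuadrant * magTrans B i - magTrans B i * projQuadrant =
      magTrans B i * (magTrans B j * mulOp (charFun O) * star (magTrans B j)) := by
  ext ψ n
  rw [sub_apply, lp.coeFn_sub, Pi.sub_apply, mul_apply_eq_comp _ (_ * _),
    magTrans.eq_def B i, weightedShift_apply, magTrans_conj_mulOp_apply]
  simp only [mul_apply_eq_comp, projQuadrant_apply, weightedShift_apply]
  have : charFun quadrant n - charFun quadrant (n - e i) = charFun O (n - e i - e j) := by
    by_cases hn : n ∈ quadrant
    · by_cases hn' : n - e i ∈ quadrant
      · rw [charFun_apply_of_mem hn, charFun_apply_of_mem hn',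
          charFun_apply_of_notMem fun h => ((h2 n).1 h).2 hn', sub_self]
      · rw [charFun_apply_of_mem hn, charFun_apply_of_notMem hn',
          charFun_apply_of_mem ((h2 n).2 ⟨hn, hn'⟩), sub_zero]
    · rw [charFun_apply_of_notMem hn, charFun_apply_of_notMem fun h => hn (h1 n h),
        charFun_apply_of_notMem fun h => hn ((h2 n).1 h).1, sub_self]
  rw [← this]
  ring

theorem commutator_zero (B : ℤ × ℤ → ℝ) :
    projQuadrant * magTrans B 0 - magTrans B 0 * projQuadrant =
      magTrans B 0 * (magTrans B 1 * projU 0 * star (magTrans B 1)) := by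
  refine commutator_projQuadrant_of_charFun B 0 1 _ (fun n => ?_) fun n => ?_
  · simp only [mem_quadrant, e, Matrix.cons_val_zero, Prod.fst_sub, Prod.snd_sub]
    omega
  · simp only [mem_quadrant, mem_upHalfLine_zero, e, Matrix.cons_val_zero, Matrix.cons_val_one,
      Prod.fst_sub, Prod.snd_sub]
    omega

theorem commutator_one (B : ℤ × ℤ → ℝ) :
    projQuadrant * magTrans B 1 - magTrans B 1 * projQuadrant =
      magTrans B 1 * (magTrans B 0 * projR 0 * star (magTrans B 0)) := by
  refine commutator_projQuadrant_of_charFun B 1 0 _ (fun n => ?_) fun n => ?_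
  · simp only [mem_quadrant, e, Matrix.cons_val_one, Matrix.cons_val_fin_one, Prod.fst_sub,
      Prod.snd_sub]
    omega
  · simp only [mem_quadrant, mem_rightHalfLine_zero, e, Matrix.cons_val_zero, Matrix.cons_val_one,
      Prod.fst_sub, Prod.snd_sub]
    omega

/-! ### The quarter-plane projection modulo the half-line ideal -/

section QuarterPlane

variable {bq bs : ℝ} (h : ∀ k : ℤ, bq - bs ≠ 2 * Real.pi * k)

/-- The projection onto the quarter plane as an element of the quarter-plane algebra. -/
def quadrantProj : QPAlg bq bs := ⟨projQuadrant, projQuadrant_mem h⟩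

theorem quadrantProj_eq :
    quadrantProj h = (Complex.exp (Complex.I * bq) - Complex.exp (Complex.I * bs))⁻¹ •
      (f (quarterField bq bs) - Complex.exp (Complex.I * bs) • 1) :=
  Subtype.ext (projQuadrant_eq h)

theorem quadrantProj_commutator_zero :
    quadrantProj h * s _ 0 - s _ 0 * quadrantProj h = s _ 0 * (s _ 1 * u₀ h * star (s _ 1)) :=
  Subtype.ext (commutator_zero _)

theorem quadrantProj_commutator_one :
    quadrantProj h * s _ 1 - s _ 1 * quadrantProj h = s _ 1 * (s _ 0 * r₀ h * star (s _ 0)) :=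
  Subtype.ext (commutator_one _)

theorem quadrantProj_commutator_mem (j : Fin 2) :
    quadrantProj h * s _ j - s _ j * quadrantProj h ∈ closedIdeal {r₀ h, u₀ h} := by
  have hr : r₀ h ∈ closedIdeal {r₀ h, u₀ h} := subset_closedIdeal (by simp)
  have hu : u₀ h ∈ closedIdeal {r₀ h, u₀ h} := subset_closedIdeal (by simp)
  fin_cases j
  · exact (quadrantProj_commutator_zero h).symm ▸ closedIdeal_mul_left _
      (closedIdeal_mul_right _ (closedIdeal_mul_left _ hu))
  · exact (quadrantProj_commutator_one h).symm ▸ closedIdeal_mul_left _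
      (closedIdeal_mul_right _ (closedIdeal_mul_left _ hr))

/-- A homomorphism that maps the projection onto the quarter plane to a central element
annihilates the closed ideal generated by the half-line projections. -/
theorem closedIdeal_subset_ker_of_commute {A' : Type*} [CStarAlgebra A']
    {φ : QPAlg bq bs →⋆ₐ[ℂ] A'} (hφ : ∀ y, Commute (φ (quadrantProj h)) y) :
    closedIdeal {r₀ h, u₀ h} ⊆ TwoSidedIdeal.ker φ := by
  have key : ∀ (i j : Fin 2) (w : QPAlg bq bs),
      quadrantProj h * s _ i - s _ i * quadrantProj h = s _ i * (s _ j * w * star (s _ j)) →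
      φ w = 0 := fun i j w hw => by
    have hz : φ (s _ i * (s _ j * w * star (s _ j))) = 0 := by
      rw [← hw, map_sub, map_mul, map_mul, (hφ _).eq, sub_self]
    -- Undoing the unitaries recovers `w` from the commutator, which the homomorphism kills.
    have hw' : w = star (s _ j) * (star (s _ i) * (s _ i * (s _ j * w * star (s _ j)))) * s _ j := by
      simp only [← mul_assoc]
      rw [mul_assoc _ (star (s _ i)), star_s_mul_self, mul_one, star_s_mul_self, one_mul,
        mul_assoc, star_s_mul_self, mul_one]
    rw [hw', map_mul, map_mul, map_mul _ (star (s _ i)), hz, mul_zero, mul_zero, zero_mul]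
  refine closedIdeal_subset_ker ?_
  rintro x (rfl | rfl)
  · exact key 1 0 _ (quadrantProj_commutator_one h)
  · exact key 0 1 _ (quadrantProj_commutator_zero h)

theorem map_f_of_map_s {B : ℤ × ℤ → ℝ} {b : ℝ} {φ : magAlg B →⋆ₐ[ℂ] magAlg (constField b)}
    (hφ : ∀ j, φ (s B j) = s (constField b) j) :
    φ (f B) = Complex.exp (Complex.I * b) • 1 := by
  rw [f_eq, map_mul, map_mul, map_mul, map_star, map_star, hφ, hφ, ← f_eq, f_constField]

theorem map_quadrantProj_eq_one {φ : QPAlg bq bs →⋆ₐ[ℂ] magAlg (constField bq)}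
    (hφ : ∀ j, φ (s _ j) = s (constField bq) j) : φ (quadrantProj h) = 1 := by
  rw [quadrantProj_eq, map_smul, map_sub, map_smul, map_one, map_f_of_map_s hφ, ← sub_smul,
    smul_smul, inv_mul_cancel₀ (exp_sub_ne_zero h), one_smul]

theorem map_quadrantProj_eq_zero {φ : QPAlg bq bs →⋆ₐ[ℂ] magAlg (constField bs)}
    (hφ : ∀ j, φ (s _ j) = s (constField bs) j) : φ (quadrantProj h) = 0 := by
  rw [quadrantProj_eq, map_smul, map_sub, map_smul, map_one, map_f_of_map_s hφ, sub_self,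
    smul_zero]

end QuarterPlane

theorem adjoin_range_star {R ι : Type*} [CStarAlgebra R] (x : ι → R) :
    StarAlgebra.adjoin ℂ (Set.range fun j => star (x j)) =
      StarAlgebra.adjoin ℂ (Set.range x) := by
  refine le_antisymm (StarAlgebra.adjoin_le ?_) (StarAlgebra.adjoin_le ?_)
  · rintro _ ⟨j, rfl⟩
    exact star_mem (StarAlgebra.subset_adjoin ℂ _ ⟨j, rfl⟩)
  · rintro _ ⟨j, rfl⟩
    rw [← star_star (x j)]
    exact star_mem (StarAlgebra.subset_adjoin ℂ _ ⟨j, rfl⟩)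

/-- Density is enough to identify the compressions as right inverses, and these then give
surjectivity. -/
theorem denseRange_of_map_s {B : ℤ × ℤ → ℝ} {b : ℝ} {φ : magAlg B →⋆ₐ[ℂ] magAlg (constField b)}
    (hφ : ∀ j, φ (s B j) = s (constField b) j) : DenseRange φ := by
  intro T
  rw [closure_subtype]
  refine closure_mono ?_ T.2
  have h : StarAlgebra.adjoin ℂ (Set.range (magTrans (constField b))) ≤
      φ.range.map (magAlg (constField b)).subtype := by
    refine StarAlgebra.adjoin_le ?_
    rintro _ ⟨j, rfl⟩
    exact ⟨s (constField b) j, ⟨s B j, hφ j⟩, rfl⟩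
  intro T hT
  obtain ⟨y, ⟨z, hz⟩, hy⟩ := h hT
  exact ⟨y, ⟨z, hz⟩, hy⟩

theorem starAlgHom_ext {B : ℤ × ℤ → ℝ} {A' : Type*} [CStarAlgebra A'] {φ ψ : magAlg B →⋆ₐ[ℂ] A'}
    (h : ∀ j, φ (s B j) = ψ (s B j)) : φ = ψ := by
  refine StarAlgHom.ext_topologicalClosure (continuous_starAlgHom φ) (continuous_starAlgHom ψ)
    (StarAlgHom.ext_adjoin ?_)
  rintro ⟨_, hx⟩ ⟨j, rfl⟩
  exact h j

/-! ### Lifting the bulk algebras by compression -/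

section QuarterPlane

variable {bq bs : ℝ}

theorem projQuadrant_corner_mem (h : ∀ k : ℤ, bq - bs ≠ 2 * Real.pi * k) :
    ∀ T ∈ magAlg (constField bq),
    projQuadrant * T * projQuadrant ∈ magAlg (quarterField bq bs) := by
  have hu := star_magTrans_mul_self (constField bq)
  have hu' := magTrans_mul_star_self (constField bq)
  have hc := quasiCommute_magTrans bq
  intro T hT
  refine (isCompression_projQuadrant bq bs).corner_mem (isClosed_magAlg _) (projQuadrant_mem h)
    (fun j => star_mem (magTrans_mem _ j)) (fun i j => ?_) (fun i j => ?_)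
    (by rwa [adjoin_range_star])
  · rw [star_star]
    exact ((hc i j).symm.star_left (hu j) (hu' j)).symm
  · rw [star_star, star_star]
    exact hc i j

theorem one_sub_projQuadrant_corner_mem (h : ∀ k : ℤ, bq - bs ≠ 2 * Real.pi * k) :
    ∀ T ∈ magAlg (constField bs),
    (1 - projQuadrant) * T * (1 - projQuadrant) ∈ magAlg (quarterField bq bs) := by
  have hu := star_magTrans_mul_self (constField bs)
  have hu' := magTrans_mul_star_self (constField bs)
  have hc := quasiCommute_magTrans bs
  exact fun T hT => (isCompression_one_sub_projQuadrant bq bs).corner_mem (isClosed_magAlg _)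
    (sub_mem (one_mem _) (projQuadrant_mem h)) (magTrans_mem _)
    (fun i j => (hc i j).star_left (hu i) (hu' i))
    (fun i j => (hc i j).star_star (hu i) (hu' i) (hu j) (hu' j)) hT

/-- The compression of `A_{bq}` to the quarter plane. -/
def cornerQuadrant (h : ∀ k : ℤ, bq - bs ≠ 2 * Real.pi * k) :
    magAlg (constField bq) →ₗ[ℂ] QPAlg bq bs :=
  IsCompression.cornerMap _ _ _ (projQuadrant_corner_mem h)

/-- The compression of `A_{bs}` to the complement of the quarter plane. -/
def cornerCompl (h : ∀ k : ℤ, bq - bs ≠ 2 * Real.pi * k) :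
    magAlg (constField bs) →ₗ[ℂ] QPAlg bq bs :=
  IsCompression.cornerMap _ _ _ (one_sub_projQuadrant_corner_mem h)

/-- The factor `quadrantProj h` shows that the evaluation at `bs` kills this compression. -/
theorem cornerQuadrant_eq_mul (h : ∀ k : ℤ, bq - bs ≠ 2 * Real.pi * k)
    (T : magAlg (constField bq)) :
    cornerQuadrant h T = quadrantProj h * cornerQuadrant h T := Subtype.ext <| by
  change projQuadrant * T * projQuadrant = projQuadrant * (projQuadrant * T * projQuadrant)
  simp only [← mul_assoc, projQuadrant_mul_self]

theorem cornerCompl_eq_mul (h : ∀ k : ℤ, bq - bs ≠ 2 * Real.pi * k)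
    (T : magAlg (constField bs)) :
    cornerCompl h T = (1 - quadrantProj h) * cornerCompl h T := Subtype.ext <| by
  change (1 - projQuadrant) * T * (1 - projQuadrant) =
    (1 - projQuadrant) * ((1 - projQuadrant) * T * (1 - projQuadrant))
  simp only [← mul_assoc, (isCompression_one_sub_projQuadrant bq bs).mul_self]

theorem commutator_star_mem (h : ∀ k : ℤ, bq - bs ≠ 2 * Real.pi * k) (j : Fin 2) :
    star (s _ j) * quadrantProj h - quadrantProj h * star (s _ j) ∈ closedIdeal {r₀ h, u₀ h} := by
  let z := s (quarterField bq bs) j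
  have : star z * quadrantProj h - quadrantProj h * star z =
      star z * (quadrantProj h * z - z * quadrantProj h) * star z := by
    have h1 : z * star z = 1 := s_mul_star_self _ j
    have h2 : star z * z = 1 := star_s_mul_self _ j
    rw [mul_sub, sub_mul, ← mul_assoc, mul_assoc _ z (star z), h1, mul_one, ← mul_assoc, h2,
      one_mul]
  rw [this]
  exact closedIdeal_mul_right _ (closedIdeal_mul_left _ (quadrantProj_commutator_mem h j))

theorem mul_quadrantProj_sub_mem (h : ∀ k : ℤ, bq - bs ≠ 2 * Real.pi * k)
    {φ : QPAlg bq bs →⋆ₐ[ℂ] magAlg (constField bq)}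
    (hφ : ∀ j, φ (s _ j) = s (constField bq) j) (y : QPAlg bq bs) :
    y * quadrantProj h - cornerQuadrant h (φ y) ∈ closedIdeal {r₀ h, u₀ h} := by
  refine (isCompression_projQuadrant bq bs).mul_sub_cornerMap_mem
    (J := closedIdealSubmodule {r₀ h, u₀ h}) (φ := φ) (projQuadrant_corner_mem h)
    (isClosed_magAlg _) (by rw [adjoin_range_star]; rfl) (fun j => star_mem (magTrans_mem _ j))
    (fun j => star_mem (magTrans_mem _ j)) (fun j => ?_) (fun j => ?_) (projQuadrant_mem h)
    (continuous_starAlgHom φ) (fun j => ?_) isClosed_closure (fun a _ => closedIdeal_mul_left a)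
    (fun a _ => closedIdeal_mul_right a) (fun j => ?_) y
  · rw [star_star, star_magTrans_mul_self]
  · rw [star_star, magTrans_mul_star_self]
  · have : φ (star (s (quarterField bq bs) j)) = star (s (constField bq) j) := by
      rw [map_star, hφ]
    exact this
  · exact commutator_star_mem h j

theorem mul_one_sub_quadrantProj_sub_mem (h : ∀ k : ℤ, bq - bs ≠ 2 * Real.pi * k)
    {φ : QPAlg bq bs →⋆ₐ[ℂ] magAlg (constField bs)}
    (hφ : ∀ j, φ (s _ j) = s (constField bs) j) (y : QPAlg bq bs) :
    y * (1 - quadrantProj h) - cornerCompl h (φ y) ∈ closedIdeal {r₀ h, u₀ h} := by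
  refine (isCompression_one_sub_projQuadrant bq bs).mul_sub_cornerMap_mem
    (J := closedIdealSubmodule {r₀ h, u₀ h}) (φ := φ) (one_sub_projQuadrant_corner_mem h)
    (isClosed_magAlg _) le_rfl (magTrans_mem _) (magTrans_mem _) (magTrans_mul_star_self _)
    (star_magTrans_mul_self _) (sub_mem (one_mem _) (projQuadrant_mem h))
    (continuous_starAlgHom φ) hφ isClosed_closure (fun a _ => closedIdeal_mul_left a)
    (fun a _ => closedIdeal_mul_right a) (fun j => ?_) y
  have : s _ j * (1 - quadrantProj h) - (1 - quadrantProj h) * s _ j =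
      quadrantProj h * s _ j - s _ j * quadrantProj h := by
    rw [mul_sub, sub_mul, mul_one, one_mul]
    abel
  exact this ▸ quadrantProj_commutator_mem h j

/-- For `T = φ y` the compression equals `y P` modulo an ideal killed by `φ`, and `φ P = 1`; density
and continuity extend this to all `T`. -/
theorem map_cornerQuadrant (h : ∀ k : ℤ, bq - bs ≠ 2 * Real.pi * k)
    {φ : QPAlg bq bs →⋆ₐ[ℂ] magAlg (constField bq)}
    (hφ : ∀ j, φ (s _ j) = s (constField bq) j) (T : magAlg (constField bq)) :
    φ (cornerQuadrant h T) = T := by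
  have hP := map_quadrantProj_eq_one h hφ
  refine congrFun ((denseRange_of_map_s hφ).equalizer (g := φ ∘ cornerQuadrant h)
    ((continuous_starAlgHom φ).comp (IsCompression.continuous_cornerMap _)) continuous_id
    (funext fun y => ?_)) T
  have hy := closedIdeal_subset_ker_of_commute h (φ := φ) (fun y => hP ▸ Commute.one_left y)
    (mul_quadrantProj_sub_mem h hφ y)
  rw [SetLike.mem_coe, TwoSidedIdeal.mem_ker, map_sub, map_mul, hP, mul_one, sub_eq_zero] at hy
  exact hy.symm

theorem map_cornerCompl (h : ∀ k : ℤ, bq - bs ≠ 2 * Real.pi * k)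
    {φ : QPAlg bq bs →⋆ₐ[ℂ] magAlg (constField bs)}
    (hφ : ∀ j, φ (s _ j) = s (constField bs) j) (T : magAlg (constField bs)) :
    φ (cornerCompl h T) = T := by
  have hP := map_quadrantProj_eq_zero h hφ
  refine congrFun ((denseRange_of_map_s hφ).equalizer (g := φ ∘ cornerCompl h)
    ((continuous_starAlgHom φ).comp (IsCompression.continuous_cornerMap _)) continuous_id
    (funext fun y => ?_)) T
  have hy := closedIdeal_subset_ker_of_commute h (φ := φ) (fun y => hP ▸ Commute.zero_left y)
    (mul_one_sub_quadrantProj_sub_mem h hφ y)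
  rw [SetLike.mem_coe, TwoSidedIdeal.mem_ker, map_sub, map_mul, map_sub, map_one, hP, sub_zero,
    mul_one, sub_eq_zero] at hy
  exact hy.symm

end QuarterPlane

end MagneticQP

end

open MagneticQP

theorem mainTheorem10 (bq bs : ℝ) (h : ∀ k : ℤ, bq - bs ≠ 2 * Real.pi * k) :
    ∃ ev : MagneticQP.QPAlg bq bs →⋆ₐ[ℂ] MagneticQP.BulkAlg bq bs,
      MagneticQP.IsEvaluation ev ∧
      (∀ ev' : MagneticQP.QPAlg bq bs →⋆ₐ[ℂ] MagneticQP.BulkAlg bq bs,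
        MagneticQP.IsEvaluation ev' → ev' = ev) ∧
      (TwoSidedIdeal.ker ev : Set (MagneticQP.QPAlg bq bs)) =
        MagneticQP.closedIdeal {MagneticQP.r₀ h, MagneticQP.u₀ h} := by
  obtain ⟨φ, hφ⟩ := exists_evaluation_quadrant bq bs
  obtain ⟨χ, hχ⟩ := exists_evaluation_compl_quadrant bq bs
  have hφP := map_quadrantProj_eq_one h hφ
  have hχP := map_quadrantProj_eq_zero h hχ
  have hs : ∀ j, (φ.prod χ) (s (quarterField bq bs) j) = (s (constField bq) j, s (constField bs) j) :=
    fun j => Prod.ext (hφ j) (hχ j)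
  refine ⟨φ.prod χ, ⟨?_, hs, Prod.ext (map_f_of_map_s hφ) (map_f_of_map_s hχ)⟩, fun ev' hev' =>
    starAlgHom_ext fun j => (hev'.map_s j).trans (hs j).symm, ?_⟩
  · rintro ⟨T, T'⟩
    -- Each evaluation inverts its own compression and kills the other one.
    refine ⟨cornerQuadrant h T + cornerCompl h T', Prod.ext ?_ ?_⟩
    · change φ _ = T
      rw [map_add, map_cornerQuadrant h hφ, cornerCompl_eq_mul, map_mul, map_sub, map_one, hφP,
        sub_self, zero_mul, add_zero]
    · change χ _ = T'
      rw [map_add, map_cornerCompl h hχ, cornerQuadrant_eq_mul, map_mul, hχP, zero_mul, zero_add]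
  · refine Set.Subset.antisymm (fun y hy => ?_) (closedIdeal_subset_ker_of_commute h fun y => ?_)
    · rw [SetLike.mem_coe, TwoSidedIdeal.mem_ker] at hy
      have h1 := mul_quadrantProj_sub_mem h hφ y
      have h2 := mul_one_sub_quadrantProj_sub_mem h hχ y
      rw [show φ y = 0 from congrArg Prod.fst hy, map_zero, sub_zero] at h1
      rw [show χ y = 0 from congrArg Prod.snd hy, map_zero, sub_zero] at h2
      -- With both images zero the compressions vanish, so `y P` and `y (1 - P)` lie in the ideal,
      -- and they sum to `y`.
      have h3 := (closedIdealSubmodule {r₀ h, u₀ h}).add_mem h1 h2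
      rw [← mul_add, add_sub_cancel, mul_one] at h3
      exact h3
    · have : (φ.prod χ) (quadrantProj h) = (1, 0) := Prod.ext hφP hχP
      rw [this]
      exact Prod.ext (Commute.one_left y.1) (Commute.zero_left y.2)
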